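/- Let $\mathbb{F}_q$ be a finite field. Let $\mathcal{I}_q^n$ be the set of monic irreducible polynomials of degree $n$ in $\mathbb{F}_q[x]$, $\mathcal{I}_q=\bigcup_{n\ge 1}\mathcal{I}_q^n$, and $N_q(n)=|\mathcal{I}_q^n|$. For $A=\begin{pmatrix} a&b\\ c&d\end{pmatrix}\in\operatorname{GL}_2(\mathbb{F}_q)$ with class $[A]\in\operatorname{PGL}_2(\mathbb{F}_q)$ write $[A]\circ x=\frac{ax+b}{cx+d}$, and for $0\neq f\in\mathbb{F}_q[x]$ let $[A]\ast f$ be the monic scalar multiple of $(cx+d)^{\deg f}f\left(\frac{ax+b}{cx+d}\right)$. For a subgroup $G\le\operatorname{PGL}_2(\mathbb{F}_q)$ put $G\ast r=\{[A]\ast r : [A]\in G\}$ and $$\omega_G(n,k)=\left|\{G\ast r : r\in\mathcal{I}_q^n,\ |G\ast r|=k\}\right|.$$ A quotient map for $G$ is a rational function $Q=g/h$ with $g,h\in\mathbb{F}_q[x]$ coprime, $h\ne 0$, $g$ monic and $\deg h<\deg g=|G|$, such that $\mathbb{F}_q(Q)$ is the field of all $R\in\mathbb{F}_q(x)$ with $R([A]\circ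 x)=R(x)$ for all $[A]\in G$. For such $Q$ and $F\in\mathbb{F}_q[x]$ let $F^Q=h^{\deg F}F(g/h)\in\mathbb{F}_q[x]$. Let $d(G)$ be the largest degree of an $F\in\mathcal{I}_q$ such that $F^Q=\left(\prod_{t\in G\ast r}t\right)^k$ for some integer $k>1$ and some $r\in\mathcal{I}_q$ having no root in $\{[A]\circ\infty : [A]\in G\}$, with $d(G)=0$ if no such $F$ exists; this number does not depend on the choice of the quotient map $Q$ for $G$, and $d(G)\le 2$. If $G\le\operatorname{PGL}_2(\mathbb{F}_q)$ is a cyclic subgroup of prime order $s$, then for all integers $m>d(G)$ $$N_q(m)=\omega_G(m,s)+\omega_G(ms,1).$$ -/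

import Mathlib

open Polynomial
open scoped MatrixGroups

noncomputable section

namespace PolyOrbit

variable {F : Type*} [Field F]

/-- `h ^ deg f * f (g / h)`, written out as the polynomial `∑ i, fᵢ * g ^ i * h ^ (deg f - i)`. -/
def ratTransform (g h f : F[X]) : F[X] :=
  ∑ i ∈ Finset.range (f.natDegree + 1), C (f.coeff i) * g ^ i * h ^ (f.natDegree - i)

/-- The scalar multiple of `f` that is monic (and `0` for `f = 0`). -/
def makeMonic (f : F[X]) : F[X] := C f.leadingCoeff⁻¹ * f

/-- For `A = (a, b; c, d)`, the monic scalar multiple of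
`(c x + d) ^ deg f * f ((a x + b) / (c x + d))`. -/
def glAct (A : GL (Fin 2) F) (f : F[X]) : F[X] :=
  makeMonic (ratTransform (C (A 0 0) * X + C (A 0 1)) (C (A 1 0) * X + C (A 1 1)) f)

theorem makeMonic_C_mul {u : F} (hu : u ≠ 0) (f : F[X]) : makeMonic (C u * f) = makeMonic f := by
  have h : C u⁻¹ * C u = (1 : F[X]) := by rw [← C_mul, inv_mul_cancel₀ hu, C_1]
  simp only [makeMonic, leadingCoeff_mul, leadingCoeff_C, mul_inv, C_mul]
  calc C u⁻¹ * C f.leadingCoeff⁻¹ * (C u * f)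
      = (C u⁻¹ * C u) * (C f.leadingCoeff⁻¹ * f) := by ring
    _ = _ := by rw [h, one_mul]

theorem ratTransform_C_mul (u : F) (g h f : F[X]) :
    ratTransform (C u * g) (C u * h) f = C (u ^ f.natDegree) * ratTransform g h f := by
  simp only [ratTransform, Finset.mul_sum]
  refine Finset.sum_congr rfl fun i hi => ?_
  have hi' : i + (f.natDegree - i) = f.natDegree := by
    have := Finset.mem_range.mp hi
    omega
  have hp : C (u ^ f.natDegree) = C u ^ i * C u ^ (f.natDegree - i) := by
    rw [← pow_add, hi', C_pow]
  rw [hp, mul_pow, mul_pow]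
  ring

theorem glAct_mul_scalar (A : GL (Fin 2) F) (u : Fˣ) (f : F[X]) :
    glAct (A * .scalar (Fin 2) u) f = glAct A f := by
  have e : ∀ i j, (A * Matrix.GeneralLinearGroup.scalar (Fin 2) u : GL (Fin 2) F) i j
      = u * A i j := by
    intro i j
    simp [Matrix.mul_apply, Matrix.scalar_apply, Matrix.diagonal_apply]
    fin_cases j <;> simp [mul_comm]
  have e2 : ∀ a b : F, C (u * a) * X + C (u * b) = C (u : F) * (C a * X + C b) := by
    intro a b
    simp only [C_mul]
    ring
  simp only [glAct, e, e2, ratTransform_C_mul]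
  exact makeMonic_C_mul (pow_ne_zero _ u.ne_zero) _

/-- The operation `[A] ∗ f` of `PGL₂(F)` on polynomials over `F`. -/
def pglAct (x : PGL(2, F)) (f : F[X]) : F[X] :=
  Quotient.liftOn' (s₁ := QuotientGroup.leftRel (Subgroup.center (GL (Fin 2) F))) x
    (fun A => glAct A f) fun A B hAB => by
      obtain ⟨u, rfl⟩ := Matrix.ProjGenLinGroup.mk_eq_mk_iff.mp
        (show Matrix.ProjGenLinGroup.mk A = Matrix.ProjGenLinGroup.mk B from Quotient.sound' hAB)
      exact (glAct_mul_scalar A u f).symm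

theorem pglAct_mk (A : GL (Fin 2) F) (f : F[X]) :
    pglAct (Matrix.ProjGenLinGroup.mk A) f = glAct A f := rfl

/-- `G ∗ r = {[A] ∗ r | [A] ∈ G}`. -/
def orbit (G : Subgroup PGL(2, F)) (r : F[X]) : Set F[X] := {t | ∃ x ∈ G, pglAct x r = t}

/-- The linear rational function `(a x + b) / (c x + d)` belonging to `A = (a, b; c, d)`. -/
def mobius (A : GL (Fin 2) F) : RatFunc F :=
  (RatFunc.C (A 0 0) * RatFunc.X + RatFunc.C (A 0 1)) /
    (RatFunc.C (A 1 0) * RatFunc.X + RatFunc.C (A 1 1))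

/-- The set `F(x)^G` of all rational functions `Q` with `Q ((a x + b) / (c x + d)) = Q (x)` for
all `[(a, b; c, d)] ∈ G`. -/
def invariantFunctions (G : Subgroup PGL(2, F)) : Set (RatFunc F) :=
  {Q | ∀ A : GL (Fin 2) F, Matrix.ProjGenLinGroup.mk A ∈ G →
    RatFunc.eval RatFunc.C (mobius A) Q = Q}

/-- `Q = g / h` (in lowest terms, `g` monic) is a quotient map for `G`: it generates the field
`F(x)^G` over `F`, and `deg h < deg g = |G|`. -/
structure IsQuotientMap (G : Subgroup PGL(2, F)) (g h : F[X]) : Prop where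
  monic : g.Monic
  ne_zero : h ≠ 0
  coprime : IsCoprime g h
  natDegree_num : g.natDegree = Nat.card G
  natDegree_lt : h.natDegree < g.natDegree
  adjoin_eq : (IntermediateField.adjoin F
    {algebraMap F[X] (RatFunc F) g / algebraMap F[X] (RatFunc F) h} : Set (RatFunc F))
      = invariantFunctions G

/-- The monic irreducible polynomials of degree `n`. -/
def monicIrreducibles (F : Type*) [Field F] (n : ℕ) : Set F[X] :=
  {f | f.Monic ∧ Irreducible f ∧ f.natDegree = n}

/-- The monic polynomials with no zero in the orbit `G ∘ ∞` (the point `∞` itself is never a zero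
of a monic polynomial). -/
def nonRoot (G : Subgroup PGL(2, F)) : Set F[X] :=
  open Classical in
  {f | f.Monic ∧ ∀ A : GL (Fin 2) F, Matrix.ProjGenLinGroup.mk A ∈ G →
    ∀ α : F, A • (OnePoint.infty : OnePoint F) = (α : OnePoint F) → f.eval α ≠ 0}

/-- `f ^ Q` for `Q = g / h` is a proper power of a `G`-orbit polynomial. -/
def IsProperPower (G : Subgroup PGL(2, F)) (g h f : F[X]) : Prop :=
  ∃ r : F[X], Irreducible r ∧ r ∈ nonRoot G ∧
    ∃ k : ℕ, 1 < k ∧ ratTransform g h f = (∏ᶠ t ∈ orbit G r, t) ^ k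

/-- `d(G)`: the largest degree of a monic irreducible `f` for which `f ^ Q`, with `Q` a quotient map
for `G`, is a proper power of a `G`-orbit polynomial, and `0` if there is none. Any two quotient
maps for `G` differ by an affine substitution, so `Q` may range over all of them; and the degrees
in question are at most `2`, so that the supremum is a maximum. -/
def d (G : Subgroup PGL(2, F)) : ℕ :=
  sSup {n | ∃ g h : F[X], IsQuotientMap G g h ∧
    ∃ f ∈ monicIrreducibles F n, IsProperPower G g h f}

/-- `N_q(n)`: the number of monic irreducible polynomials of degree `n`. -/
def N (F : Type*) [Field F] (n : ℕ) : ℕ := (monicIrreducibles F n).ncard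

/-- `ω_G(n, k)`: the number of orbits `G ∗ r` of size `k` with `r` monic irreducible of
degree `n`. -/
def omega (G : Subgroup PGL(2, F)) (n k : ℕ) : ℕ :=
  {O : Set F[X] | ∃ r ∈ monicIrreducibles F n, O = orbit G r ∧ O.ncard = k}.ncard

end PolyOrbit

end

/-! Call a point of the algebraic closure regular if no element of `G` sends it to ∞. `G` acts on
the regular points, and a quotient map Q = g/h separates the orbits. Indeed, over F(x) the
polynomial g(Y) - Q(x)h(Y) has degree |G|, and its roots are the |G| distinct images of x under `G`.
Specialising x to a regular point α shows that the fibre of Q through α is the orbit of α, each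
point counted with the order of its stabilizer (`IsQuotientMap.fibre`,
`IsQuotientMap.rootMultiplicity_fibre`). The Galois action commutes with `G`, so for f irreducible
with f(Q(α)) = 0 the transform f^Q is the orbit polynomial of the minimal polynomial of α, raised to
the order of the stabilizer of α (`IsQuotientMap.ratTransform_eq_pow`).

Hence sending f to the set of irreducible factors of f^Q embeds the monic irreducibles of degree m
into the `G`-orbits. A nontrivial stabilizer makes f^Q a proper power, so for m > d(G) all
stabilizers involved are trivial, and comparing degrees gives |G ∗ r| · deg r = ms. As s is prime,
the orbit has size s or 1, so deg r is m or ms.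

Conversely, every such orbit is hit provided the roots of r are regular
(`IsQuotientMap.image_transformFactors`). A root that is not regular is rational and forces some
element of `G` to move ∞. That element has a finite fixed point, which all of `G` then fixes, so
d(G) ≥ 1 (`one_le_d`); hence m ≥ 2, and r cannot be linear. -/

namespace PolyOrbit

/-! ### Möbius transforms of points and their minimal polynomials -/

section Mobius

variable {F : Type*} [Field F] {K : Type*} [Field K] [Algebra F K]

/-- The denominator `c α + d` of the Möbius transform of `α`. -/
noncomputable def den (A : GL (Fin 2) F) (α : K) : K :=
  algebraMap F K (A 1 0) * α + algebraMap F K (A 1 1)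

/-- The Möbius transform `(a α + b) / (c α + d)`. -/
noncomputable def mob (A : GL (Fin 2) F) (α : K) : K :=
  (algebraMap F K (A 0 0) * α + algebraMap F K (A 0 1)) / den A α

theorem den_mul {A B : GL (Fin 2) F} {α : K} (h : den B α ≠ 0) :
    den (A * B) α = den A (mob B α) * den B α := by
  unfold den mob at *
  simp only [Units.val_mul, Matrix.mul_apply, Fin.sum_univ_two, map_add, map_mul]
  unfold den
  field_simp
  ring

theorem mob_mul {A B : GL (Fin 2) F} {α : K} (h : den B α ≠ 0) :
    mob (A * B) α = mob A (mob B α) := by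
  have e : mob A (mob B α) =
      (algebraMap F K (A 0 0) * mob B α + algebraMap F K (A 0 1)) / den A (mob B α) := rfl
  rw [e, ← mul_div_mul_right _ (den A (mob B α)) h, ← den_mul h]
  change _ / den (A * B) α = _
  congr 1
  unfold mob
  simp only [Units.val_mul, Matrix.mul_apply, Fin.sum_univ_two, map_add, map_mul]
  field_simp
  unfold den
  ring

@[simp] theorem den_one (α : K) : den (1 : GL (Fin 2) F) α = 1 := by simp [den]

@[simp] theorem mob_one (α : K) : mob (1 : GL (Fin 2) F) α = α := by simp [mob]

theorem den_inv_mob {A : GL (Fin 2) F} {α : K} (h : den A α ≠ 0) : den A⁻¹ (mob A α) ≠ 0 := by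
  intro h0
  have := den_mul (A := A⁻¹) h
  simp [h0] at this

theorem mob_inv_mob {A : GL (Fin 2) F} {α : K} (h : den A α ≠ 0) : mob A⁻¹ (mob A α) = α := by
  rw [← mob_mul h]; simp

theorem exists_eq_scalar_mul {A B : GL (Fin 2) F}
    (h : Matrix.ProjGenLinGroup.mk A = Matrix.ProjGenLinGroup.mk B) :
    ∃ u : F, u ≠ 0 ∧ ∀ i j, B i j = u * A i j := by
  obtain ⟨u, rfl⟩ := Matrix.ProjGenLinGroup.mk_eq_mk_iff.mp h
  refine ⟨u, u.ne_zero, fun i j => ?_⟩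
  simp [Matrix.mul_apply, Matrix.scalar_apply, Matrix.diagonal_apply]
  fin_cases j <;> simp [mul_comm]

theorem den_congr {A B : GL (Fin 2) F}
    (h : Matrix.ProjGenLinGroup.mk A = Matrix.ProjGenLinGroup.mk B) {α : K} (hA : den A α ≠ 0) :
    den B α ≠ 0 := by
  obtain ⟨u, hu, e⟩ := exists_eq_scalar_mul h
  have : den B α = algebraMap F K u * den A α := by simp [den, e]; ring
  rw [this]
  exact mul_ne_zero (by simpa using hu) hA

theorem mob_congr {A B : GL (Fin 2) F}
    (h : Matrix.ProjGenLinGroup.mk A = Matrix.ProjGenLinGroup.mk B) (α : K) :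
    mob A α = mob B α := by
  obtain ⟨u, hu, e⟩ := exists_eq_scalar_mul h
  have hu' : algebraMap F K u ≠ 0 := by simpa using hu
  simp only [mob, den, e, map_mul]
  rw [← mul_div_mul_left _ _ hu']
  congr 1 <;> ring

theorem entries_det_ne_zero (A : GL (Fin 2) F) : A 0 0 * A 1 1 - A 0 1 * A 1 0 ≠ 0 := by
  have := A.det_ne_zero
  rwa [Matrix.det_fin_two] at this

theorem aeval_ratTransform (g h f : F[X]) {α : K} (hα : aeval α h ≠ 0) :
    aeval α (ratTransform g h f) =
      aeval α h ^ f.natDegree * aeval (aeval α g / aeval α h) f := by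
  rw [aeval_eq_sum_range (p := f), ratTransform, map_sum, Finset.mul_sum]
  refine Finset.sum_congr rfl fun i hi => ?_
  have hi' : i ≤ f.natDegree := Nat.lt_succ_iff.mp (Finset.mem_range.mp hi)
  rw [map_mul, map_mul, aeval_C, map_pow, map_pow, Algebra.smul_def, div_pow]
  rw [pow_sub₀ _ hα hi']
  field_simp

theorem aeval_ratTransform_of_eq_zero (g h : F[X]) {f : F[X]} (hf : f.Monic) {α : K}
    (hα : aeval α h = 0) : aeval α (ratTransform g h f) = aeval α g ^ f.natDegree := by
  rw [ratTransform, map_sum, Finset.sum_eq_single f.natDegree]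
  · simp [hf.coeff_natDegree]
  · intro i hi hne
    have hi' : i < f.natDegree := by
      have := Finset.mem_range.mp hi
      omega
    simp [hα, Nat.sub_ne_zero_of_lt hi']
  · simp

theorem aeval_num (A : GL (Fin 2) F) (α : K) :
    aeval α (C (A 0 0) * X + C (A 0 1)) =
      algebraMap F K (A 0 0) * α + algebraMap F K (A 0 1) := by simp

theorem aeval_den (A : GL (Fin 2) F) (α : K) :
    aeval α (C (A 1 0) * X + C (A 1 1)) = den A α := by simp [den]

theorem aeval_ratTransform_mob (A : GL (Fin 2) F) (f : F[X]) {α : K} (h : den A α ≠ 0) :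
    aeval α (ratTransform (C (A 0 0) * X + C (A 0 1)) (C (A 1 0) * X + C (A 1 1)) f) =
      den A α ^ f.natDegree * aeval (mob A α) f := by
  rw [aeval_ratTransform _ _ _ (by rwa [aeval_den]), aeval_num, aeval_den, mob]

theorem den_X_ne_zero (A : GL (Fin 2) F) : den A (RatFunc.X : RatFunc F) ≠ 0 := by
  intro h
  have h' : algebraMap F[X] (RatFunc F) (C (A 1 0) * X + C (A 1 1)) = 0 := by
    simpa [den] using h
  rw [FaithfulSMul.algebraMap_eq_zero_iff] at h'
  have h0 := congrArg (coeff · 0) h'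
  have h1 := congrArg (coeff · 1) h'
  simp [coeff_C] at h0 h1
  exact entries_det_ne_zero A (by simp [h0, h1])

theorem mobius_eq_mob (A : GL (Fin 2) F) : mobius A = mob A (RatFunc.X : RatFunc F) := by
  simp [mobius, mob, den]

theorem mobius_ne_C (A : GL (Fin 2) F) : ¬ ∃ c, mobius A = RatFunc.C c := by
  rintro ⟨c, hc⟩
  rw [mobius_eq_mob, mob, div_eq_iff (den_X_ne_zero A)] at hc
  have h' : algebraMap F[X] (RatFunc F) (C (A 0 0) * X + C (A 0 1)) =
      algebraMap F[X] (RatFunc F) (C c * (C (A 1 0) * X + C (A 1 1))) := by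
    simpa [den] using hc
  have h'' := FaithfulSMul.algebraMap_injective _ _ h'
  have h0 := congrArg (coeff · 0) h''
  have h1 := congrArg (coeff · 1) h''
  simp [coeff_C] at h0 h1
  exact entries_det_ne_zero A (by rw [h0, h1]; ring)

theorem transcendental_mobius (A : GL (Fin 2) F) : Transcendental F (mobius A) :=
  RatFunc.transcendental_of_ne_C _ (mobius_ne_C A)

/-- At the generic point x the transform takes the value den^deg f · f(`mobius A`), and `mobius A`
is transcendental. -/
theorem ratTransform_mob_ne_zero (A : GL (Fin 2) F) {f : F[X]} (hf : f ≠ 0) :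
    ratTransform (C (A 0 0) * X + C (A 0 1)) (C (A 1 0) * X + C (A 1 1)) f ≠ 0 := by
  intro h
  have := aeval_ratTransform_mob A f (den_X_ne_zero A)
  rw [h, map_zero, eq_comm, mul_eq_zero, ← mobius_eq_mob] at this
  rcases this with h1 | h1
  · exact pow_ne_zero _ (den_X_ne_zero A) h1
  · exact hf ((transcendental_iff.mp (transcendental_mobius A)) f h1)

theorem natDegree_ratTransform_le {g h : F[X]} {s : ℕ} (hg : g.natDegree ≤ s)
    (hh : h.natDegree ≤ s) (f : F[X]) : (ratTransform g h f).natDegree ≤ f.natDegree * s := by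
  refine natDegree_sum_le_of_forall_le _ _ fun i hi => ?_
  have hi' : i + (f.natDegree - i) = f.natDegree := by
    have := Finset.mem_range.mp hi
    omega
  calc (C (f.coeff i) * g ^ i * h ^ (f.natDegree - i)).natDegree
      ≤ 0 + i * s + (f.natDegree - i) * s :=
        natDegree_mul_le_of_le (natDegree_mul_le_of_le (natDegree_C _).le
          (natDegree_pow_le_of_le _ hg)) (natDegree_pow_le_of_le _ hh)
    _ = (i + (f.natDegree - i)) * s := by ring
    _ = _ := by rw [hi']

theorem natDegree_minpoly_mob_le (A : GL (Fin 2) F) {α : K} (hα : IsIntegral F (mob A α))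
    (h : den A α ≠ 0) : (minpoly F α).natDegree ≤ (minpoly F (mob A α)).natDegree := by
  set f := minpoly F (mob A α)
  have h0 := ratTransform_mob_ne_zero A (minpoly.ne_zero hα)
  have h1 := aeval_ratTransform_mob A f h
  rw [minpoly.aeval, mul_zero] at h1
  refine (natDegree_le_of_dvd (minpoly.dvd F α h1) h0).trans ?_
  exact (natDegree_ratTransform_le (s := 1) natDegree_linear_le natDegree_linear_le f).trans
    (mul_one _).le

theorem isIntegral_mob (A : GL (Fin 2) F) {α : K} (hα : IsIntegral F α) :
    IsIntegral F (mob A α) := by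
  have hs : ∀ a b : F, IsIntegral F (algebraMap F K a * α + algebraMap F K b) := fun a b =>
    (isIntegral_algebraMap.mul hα).add isIntegral_algebraMap
  rw [mob, div_eq_mul_inv]
  exact (hs _ _).mul (hs _ _).inv

theorem natDegree_minpoly_mob (A : GL (Fin 2) F) {α : K} (hα : IsIntegral F α)
    (h : den A α ≠ 0) : (minpoly F (mob A α)).natDegree = (minpoly F α).natDegree := by
  refine le_antisymm ?_ (natDegree_minpoly_mob_le A (isIntegral_mob A hα) h)
  have := natDegree_minpoly_mob_le A⁻¹ (α := mob A α) (by rwa [mob_inv_mob h]) (den_inv_mob h)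
  rwa [mob_inv_mob h] at this

theorem monic_makeMonic {f : F[X]} (hf : f ≠ 0) : (makeMonic f).Monic := by
  rw [makeMonic, mul_comm]
  exact monic_mul_leadingCoeff_inv hf

/-- Substituting A into a polynomial moves its roots by A⁻¹. The left side is monic, kills α, and
has degree at most that of the minimal polynomial of α, because Möbius maps preserve degrees over F.
-/
theorem glAct_minpoly_mob (A : GL (Fin 2) F) {α : K} (hα : IsIntegral F α)
    (h : den A α ≠ 0) : glAct A (minpoly F (mob A α)) = minpoly F α := by
  have hm := isIntegral_mob A hα
  set f := minpoly F (mob A α)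
  have h0 := ratTransform_mob_ne_zero A (minpoly.ne_zero hm)
  have h1 := aeval_ratTransform_mob A f h
  rw [minpoly.aeval, mul_zero] at h1
  refine eq_of_monic_of_dvd_of_natDegree_le (minpoly.monic hα) (monic_makeMonic h0) ?_ ?_
  · exact minpoly.dvd F α (by rw [glAct, makeMonic, map_mul, h1, mul_zero])
  · rw [← natDegree_minpoly_mob A hα h]
    refine (natDegree_C_mul_le _ _).trans ?_
    exact (natDegree_ratTransform_le (s := 1) natDegree_linear_le natDegree_linear_le f).trans
      (mul_one _).le

end Mobius

/-! ### Invariant field and existence of a quotient map -/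

section Substitution

variable {F : Type*} [Field F]

/-- The substitution `Q ↦ Q ((a x + b) / (c x + d))` on rational functions. -/
noncomputable def subst (A : GL (Fin 2) F) : RatFunc F →ₐ[F] RatFunc F :=
  RatFunc.liftAlgHom (aeval (mobius A)) (nonZeroDivisors_le_comap_nonZeroDivisors_of_injective _
    (transcendental_iff_injective.mp (transcendental_mobius A)))

theorem subst_div (A : GL (Fin 2) F) (p q : F[X]) :
    subst A (algebraMap F[X] (RatFunc F) p / algebraMap F[X] (RatFunc F) q) =
      aeval (mobius A) p / aeval (mobius A) q :=
  RatFunc.liftAlgHom_apply_div _ _ _ _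

theorem eval_mobius (A : GL (Fin 2) F) (Q : RatFunc F) :
    RatFunc.eval RatFunc.C (mobius A) Q = subst A Q := by
  conv_rhs => rw [← RatFunc.num_div_denom Q]
  rw [subst_div]
  rfl

theorem subst_algebraMap (A : GL (Fin 2) F) (p : F[X]) :
    subst A (algebraMap F[X] (RatFunc F) p) = aeval (mobius A) p := by
  simpa using subst_div A p 1

theorem subst_X (A : GL (Fin 2) F) : subst A RatFunc.X = mobius A := by
  simpa using subst_algebraMap A X

theorem algHom_ratFunc_ext {L : Type*} [Field L] [Algebra F L] {f g : RatFunc F →ₐ[F] L}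
    (h : f RatFunc.X = g RatFunc.X) : f = g := by
  have hp : ∀ p : F[X], f (algebraMap F[X] (RatFunc F) p) = g (algebraMap F[X] (RatFunc F) p) := by
    intro p
    rw [← RatFunc.aeval_X_left_eq_algebraMap, ← aeval_algHom_apply, ← aeval_algHom_apply, h]
  ext Q
  rw [← RatFunc.num_div_denom Q, map_div₀, map_div₀, hp, hp]

theorem map_mob {K L : Type*} [Field K] [Field L] [Algebra F K] [Algebra F L] (f : K →ₐ[F] L)
    (A : GL (Fin 2) F) (α : K) : f (mob A α) = mob A (f α) := by
  simp [mob, den, map_div₀]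

/-- Substitution reverses products; this is why `glAut` is defined with A⁻¹. -/
theorem subst_comp (A B : GL (Fin 2) F) : (subst A).comp (subst B) = subst (B * A) := by
  apply algHom_ratFunc_ext
  rw [AlgHom.comp_apply, subst_X, mobius_eq_mob, map_mob, subst_X, subst_X, mobius_eq_mob,
    mobius_eq_mob, mob_mul (den_X_ne_zero A)]

theorem subst_one : subst (1 : GL (Fin 2) F) = AlgHom.id F (RatFunc F) := by
  apply algHom_ratFunc_ext
  rw [subst_X, mobius_eq_mob, mob_one, AlgHom.id_apply]

/-- The operation of `GL₂(F)` on rational functions by field automorphisms. -/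
noncomputable def glAut : GL (Fin 2) F →* (RatFunc F ≃ₐ[F] RatFunc F) where
  toFun A := AlgEquiv.ofAlgHom (subst A⁻¹) (subst A) (by rw [subst_comp, mul_inv_cancel, subst_one])
    (by rw [subst_comp, inv_mul_cancel, subst_one])
  map_one' := by
    ext Q
    simp [subst_one]
  map_mul' A B := by
    ext Q
    simp [mul_inv_rev, ← subst_comp]

theorem mk_eq_of_mobius_eq {A B : GL (Fin 2) F} (h : mobius A = mobius B) :
    Matrix.ProjGenLinGroup.mk A = Matrix.ProjGenLinGroup.mk B := by
  have key : ∀ M : GL (Fin 2) F, mobius M = RatFunc.X →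
      M ∈ Subgroup.center (GL (Fin 2) F) := by
    intro M hM
    rw [mobius_eq_mob, mob, div_eq_iff (den_X_ne_zero M)] at hM
    have h' : algebraMap F[X] (RatFunc F) (C (M 0 0) * X + C (M 0 1)) =
        algebraMap F[X] (RatFunc F) (X * (C (M 1 0) * X + C (M 1 1))) := by
      simpa [den] using hM
    have h'' := FaithfulSMul.algebraMap_injective _ _ h'
    have h0 := congrArg (coeff · 0) h''
    have h1 := congrArg (coeff · 1) h''
    have h2 := congrArg (coeff · 2) h''
    simp [coeff_C, coeff_X, mul_add, coeff_X_mul] at h0 h1 h2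
    have hu : M 0 0 ≠ 0 := by
      intro h
      exact entries_det_ne_zero M (by rw [h, ← h2]; ring)
    rw [Matrix.GeneralLinearGroup.center_eq_range_scalar]
    refine ⟨Units.mk0 _ hu, ?_⟩
    ext i j
    fin_cases i <;> fin_cases j <;> simp [h0, ← h1, ← h2]
  -- The matrix B A⁻¹ acts as the identity on x, so it is scalar by `key`.
  have := key (B * A⁻¹) (by
    rw [mobius_eq_mob, mob_mul (den_X_ne_zero _), ← mobius_eq_mob]
    have h1 := congrArg (subst A⁻¹) h
    rw [mobius_eq_mob, mobius_eq_mob, map_mob, map_mob, subst_X, mobius_eq_mob,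
      ← mob_mul (den_X_ne_zero _), mul_inv_cancel, mob_one] at h1
    rw [mobius_eq_mob, ← h1])
  rw [← Matrix.ProjGenLinGroup.mk_eq_one, map_mul, map_inv, mul_inv_eq_one] at this
  exact this.symm

/-- The operation of `PGL₂(F)` on rational functions by field automorphisms. -/
noncomputable def pglAut : PGL(2, F) →* (RatFunc F ≃ₐ[F] RatFunc F) :=
  Matrix.ProjGenLinGroup.lift glAut (by
    ext1 u
    refine AlgEquiv.ext fun Q => ?_
    change subst (Matrix.GeneralLinearGroup.scalar (Fin 2) u)⁻¹ Q = Q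
    have : subst (Matrix.GeneralLinearGroup.scalar (Fin 2) u)⁻¹ = AlgHom.id F (RatFunc F) := by
      apply algHom_ratFunc_ext
      rw [subst_X, mobius_eq_mob, mob_congr (B := 1) (by simp), mob_one, AlgHom.id_apply]
    rw [this, AlgHom.id_apply])

theorem pglAut_mk (A : GL (Fin 2) F) (Q : RatFunc F) :
    pglAut (Matrix.ProjGenLinGroup.mk A) Q = subst A⁻¹ Q := rfl

theorem pglAut_injective : Function.Injective (pglAut : PGL(2, F) →* _) := by
  intro x y h
  obtain ⟨A, rfl⟩ := Matrix.ProjGenLinGroup.mk_surjective x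
  obtain ⟨B, rfl⟩ := Matrix.ProjGenLinGroup.mk_surjective y
  have h1 : subst A⁻¹ RatFunc.X = subst B⁻¹ RatFunc.X := by
    rw [← pglAut_mk, ← pglAut_mk, h]
  rw [subst_X, subst_X] at h1
  have := mk_eq_of_mobius_eq h1
  rwa [map_inv, map_inv, inv_inj] at this

/-- The invariant field of `G` as an intermediate field. -/
noncomputable def invariantField (G : Subgroup PGL(2, F)) : IntermediateField F (RatFunc F) :=
  IntermediateField.fixedField (G.map pglAut)

theorem coe_invariantField (G : Subgroup PGL(2, F)) :
    (invariantField G : Set (RatFunc F)) = invariantFunctions G := by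
  ext Q
  simp only [invariantField, SetLike.mem_coe, IntermediateField.mem_fixedField_iff,
    Subgroup.mem_map, invariantFunctions, Set.mem_ofPred_eq, eval_mobius]
  constructor
  · intro h A hA
    have := h _ ⟨(Matrix.ProjGenLinGroup.mk A)⁻¹, inv_mem hA, rfl⟩
    rwa [← map_inv, pglAut_mk, inv_inv] at this
  · rintro h _ ⟨x, hx, rfl⟩
    obtain ⟨A, rfl⟩ := Matrix.ProjGenLinGroup.mk_surjective x
    rw [pglAut_mk]
    exact h _ (by rw [map_inv]; exact inv_mem hx)

/-- Artin's theorem, applied to the image of `G` in the automorphism group; faithfulness identifies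
the order of that image with |G|. -/
theorem finrank_invariantField (G : Subgroup PGL(2, F)) [Finite G] :
    Module.finrank (invariantField G) (RatFunc F) = Nat.card G := by
  have : Finite (G.map pglAut) := Finite.of_surjective
    (fun x : G => (⟨pglAut x, x, x.2, rfl⟩ : G.map pglAut)) (by
      rintro ⟨_, x, hx, rfl⟩
      exact ⟨⟨x, hx⟩, rfl⟩)
  have := Fintype.ofFinite (G.map pglAut)
  rw [← Subgroup.card_map_of_injective (K := G) pglAut_injective, Nat.card_eq_fintype_card]
  exact FixedPoints.finrank_eq_card (G.map pglAut) (RatFunc F)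

open IntermediateField in
/-- The field generated by a rational function of degree `n > 0` is also generated by a fraction
`g / h` in lowest terms with `g` monic and `deg h < deg g = n`. -/
theorem exists_normalized_generator (e : RatFunc F) {n : ℕ} (hn : 0 < n)
    (he : max e.num.natDegree e.denom.natDegree = n) :
    ∃ g h : F[X], g.Monic ∧ h ≠ 0 ∧ IsCoprime g h ∧ g.natDegree = n ∧ h.natDegree < n ∧
      adjoin F {algebraMap F[X] (RatFunc F) g / algebraMap F[X] (RatFunc F) h} = adjoin F {e} := by
  suffices H : ∃ g h : F[X], h ≠ 0 ∧ IsCoprime g h ∧ g.natDegree = n ∧ h.natDegree < n ∧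
      adjoin F {algebraMap F[X] (RatFunc F) g / algebraMap F[X] (RatFunc F) h} = adjoin F {e} by
    obtain ⟨g, h, h0, hc, hg, hh, ha⟩ := H
    have hg0 : g ≠ 0 := by rintro rfl; simp at hg; omega
    have hl : g.leadingCoeff⁻¹ ≠ 0 := inv_ne_zero (leadingCoeff_ne_zero.mpr hg0)
    have hlu : IsUnit (C g.leadingCoeff⁻¹) := isUnit_C.mpr hl.isUnit
    refine ⟨g * C g.leadingCoeff⁻¹, h, monic_mul_leadingCoeff_inv hg0, h0,
      (isCoprime_mul_unit_right_left hlu g h).mpr hc, ?_, hh, ?_⟩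
    · rw [natDegree_mul_C hl, hg]
    · rw [← ha]
      have e1 : algebraMap F[X] (RatFunc F) (g * C g.leadingCoeff⁻¹) /
          algebraMap F[X] (RatFunc F) h = algebraMap F (RatFunc F) g.leadingCoeff⁻¹ *
            (algebraMap F[X] (RatFunc F) g / algebraMap F[X] (RatFunc F) h) := by
        rw [map_mul, RatFunc.algebraMap_C, ← RatFunc.algebraMap_eq_C]
        ring
      apply le_antisymm
      · rw [adjoin_simple_le_iff, e1]
        exact mul_mem (IntermediateField.algebraMap_mem _ _) (mem_adjoin_simple_self F _)
      · set q := algebraMap F[X] (RatFunc F) (g * C g.leadingCoeff⁻¹) / algebraMap F[X] (RatFunc F) h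
        rw [adjoin_simple_le_iff]
        have e2 : algebraMap F[X] (RatFunc F) g / algebraMap F[X] (RatFunc F) h =
            (algebraMap F (RatFunc F) g.leadingCoeff⁻¹)⁻¹ * q := by
          rw [e1, inv_mul_cancel_left₀ (by simpa using hl)]
        rw [e2]
        exact mul_mem (inv_mem (IntermediateField.algebraMap_mem _ _)) (mem_adjoin_simple_self F _)
  have hd0 := e.denom_ne_zero
  have hcop := e.isCoprime_num_denom
  have hinv : ∀ x : RatFunc F, adjoin F {x⁻¹} = adjoin F {x} := by
    intro x
    apply le_antisymm
    · rw [adjoin_simple_le_iff]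
      exact inv_mem (mem_adjoin_simple_self F _)
    · rw [adjoin_simple_le_iff]
      simpa using inv_mem (mem_adjoin_simple_self F x⁻¹)
  -- If the numerator has the smaller degree, invert. If the degrees agree, subtract the quotient of
  -- the leading coefficients first and then invert. Neither changes the generated field.
  rcases lt_trichotomy e.num.natDegree e.denom.natDegree with hlt | heq | hgt
  · rw [max_eq_right hlt.le] at he
    refine ⟨e.denom, e.num, ?_, hcop.symm, he, he ▸ hlt, ?_⟩
    · intro h
      rw [RatFunc.num_eq_zero_iff] at h
      simp [h] at hlt
    · rw [← hinv e]
      conv_rhs => rw [← RatFunc.num_div_denom e, inv_div]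
  · rw [heq, max_self] at he
    set c := e.num.leadingCoeff with hc
    have hn0 : e.num ≠ 0 := by rintro h; simp [h] at heq; omega
    have hdm := RatFunc.monic_denom e
    have hc0 : c ≠ 0 := leadingCoeff_ne_zero.mpr hn0
    have hlt : (e.num - C c * e.denom).degree < e.num.degree := by
      apply degree_sub_lt_left
      · rw [degree_C_mul hc0, degree_eq_natDegree hn0, degree_eq_natDegree hd0, heq]
      · exact hn0
      · simp [hdm.leadingCoeff, hc]
    have hne : e.num - C c * e.denom ≠ 0 := by
      intro h
      rw [sub_eq_zero] at h
      have : e.denom ∣ 1 := by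
        have hu : IsUnit e.denom := hcop.isUnit_of_dvd' (h ▸ dvd_mul_left _ _) dvd_rfl
        exact hu.dvd
      have := natDegree_eq_zero_of_isUnit (isUnit_of_dvd_one this)
      omega
    refine ⟨e.denom, e.num - C c * e.denom, hne, ?_, he, ?_, ?_⟩
    · rw [mul_comm]
      exact IsCoprime.sub_mul_left_right_iff.mpr hcop.symm
    · have := natDegree_lt_natDegree hne hlt
      omega
    · rw [← hinv, inv_div]
      have e1 : algebraMap F[X] (RatFunc F) (e.num - C c * e.denom) /
          algebraMap F[X] (RatFunc F) e.denom = e - algebraMap F (RatFunc F) c := by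
        conv_rhs => rw [← RatFunc.num_div_denom e]
        have : algebraMap F[X] (RatFunc F) e.denom ≠ 0 := RatFunc.algebraMap_ne_zero hd0
        rw [map_sub, map_mul, RatFunc.algebraMap_C, ← RatFunc.algebraMap_eq_C]
        field_simp
      rw [e1]
      apply le_antisymm
      · rw [adjoin_simple_le_iff]
        exact sub_mem (mem_adjoin_simple_self F _) (IntermediateField.algebraMap_mem _ _)
      · rw [adjoin_simple_le_iff]
        have := add_mem (mem_adjoin_simple_self F (e - algebraMap F (RatFunc F) c))
          (IntermediateField.algebraMap_mem _ c)
        rwa [sub_add_cancel] at this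
  · rw [max_eq_left hgt.le] at he
    exact ⟨e.num, e.denom, hd0, hcop, he, he ▸ hgt, by rw [RatFunc.num_div_denom]⟩

/-- Lüroth's theorem gives a generator of the invariant field, and its degree as a rational function
equals the degree of the extension, which is |G|. -/
theorem exists_isQuotientMap (G : Subgroup PGL(2, F)) [Finite G] :
    ∃ g h : F[X], IsQuotientMap G g h := by
  set e := RatFunc.Luroth.generator (invariantField G)
  have hE : invariantField G = IntermediateField.adjoin F {e} :=
    RatFunc.Luroth.eq_adjoin_generator (E := invariantField G)
  have hr := finrank_invariantField G
  rw [hE, RatFunc.finrank_eq_max_natDegree] at hr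
  obtain ⟨g, h, hg, h0, hc, hgn, hhn, ha⟩ := exists_normalized_generator e Nat.card_pos hr
  exact ⟨g, h, hg, h0, hc, hgn, hgn ▸ hhn, by rw [ha, ← hE, coe_invariantField]⟩

end Substitution

/-! ### Fibres of the quotient map -/

section Fibres

variable {F : Type*} [Field F]

/-- A matrix representing an element of `PGL₂(F)`. -/
noncomputable def rep (x : PGL(2, F)) : GL (Fin 2) F :=
  Function.surjInv Matrix.ProjGenLinGroup.mk_surjective x

@[simp] theorem mk_rep (x : PGL(2, F)) : Matrix.ProjGenLinGroup.mk (rep x) = x :=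
  Function.surjInv_eq _ x

variable {K : Type*} [Field K] [Algebra F K]

/-- The points `α` of `K` that no element of `G` maps to `∞`. -/
def regularPoints (K : Type*) [Field K] [Algebra F K] (G : Subgroup PGL(2, F)) : Set K :=
  {α | ∀ A : GL (Fin 2) F, Matrix.ProjGenLinGroup.mk A ∈ G → den A α ≠ 0}

theorem mob_mem_regularPoints {G : Subgroup PGL(2, F)} {α : K} (hα : α ∈ regularPoints K G)
    {A : GL (Fin 2) F} (hA : Matrix.ProjGenLinGroup.mk A ∈ G) : mob A α ∈ regularPoints K G := by
  intro B hB h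
  have h1 := hα (B * A) (by rw [map_mul]; exact mul_mem hB hA)
  rw [den_mul (hα A hA), h, zero_mul] at h1
  exact h1 rfl

variable {G : Subgroup PGL(2, F)} {g h : F[X]}

theorem IsQuotientMap.subst_eq (hQ : IsQuotientMap G g h) {A : GL (Fin 2) F}
    (hA : Matrix.ProjGenLinGroup.mk A ∈ G) :
    aeval (mobius A) g / aeval (mobius A) h =
      algebraMap F[X] (RatFunc F) g / algebraMap F[X] (RatFunc F) h := by
  have : algebraMap F[X] (RatFunc F) g / algebraMap F[X] (RatFunc F) h ∈
      invariantFunctions G := by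
    rw [← hQ.adjoin_eq]
    exact IntermediateField.mem_adjoin_simple_self F _
  have := this A hA
  rwa [eval_mobius, subst_div] at this

theorem IsQuotientMap.monic_sub (hQ : IsQuotientMap G g h) (β : K) :
    (g.map (algebraMap F K) - C β * h.map (algebraMap F K)).Monic ∧
    (g.map (algebraMap F K) - C β * h.map (algebraMap F K)).natDegree = Nat.card G := by
  have hm := hQ.monic.map (algebraMap F K)
  have hd : (C β * h.map (algebraMap F K)).degree < (g.map (algebraMap F K)).degree := by
    rw [degree_map]
    calc _ ≤ (C β).degree + (h.map (algebraMap F K)).degree := degree_mul_le _ _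
      _ ≤ 0 + h.degree := add_le_add degree_C_le (by rw [degree_map])
      _ = h.degree := zero_add _
      _ < g.degree := degree_lt_degree hQ.natDegree_lt
  refine ⟨hm.sub_of_left hd, ?_⟩
  rw [natDegree_eq_of_degree_eq (degree_sub_eq_left_of_degree_lt hd), natDegree_map,
    hQ.natDegree_num]

/-- By invariance of Q each `mobius` image of x is a root; distinct classes give distinct roots, so
these already exhaust the degree |G|. -/
theorem IsQuotientMap.generic_fibre [Fintype G] (hQ : IsQuotientMap G g h) :
    g.map (algebraMap F (RatFunc F)) -
      C (algebraMap F[X] (RatFunc F) g / algebraMap F[X] (RatFunc F) h) *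
        h.map (algebraMap F (RatFunc F)) =
    ∏ x : G, (X - C (mobius (rep (x : PGL(2, F))))) := by
  obtain ⟨hm, hd⟩ := hQ.monic_sub
    (algebraMap F[X] (RatFunc F) g / algebraMap F[X] (RatFunc F) h)
  refine eq_of_monic_of_dvd_of_natDegree_le
    (monic_prod_of_monic _ _ fun x _ => monic_X_sub_C _) hm ?_ ?_
  · refine Finset.prod_dvd_of_coprime ?_ ?_
    · intro x _ y _ hxy
      refine isCoprime_X_sub_C_of_isUnit_sub (sub_ne_zero.mpr fun h => hxy ?_).isUnit
      have := mk_eq_of_mobius_eq h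
      rw [mk_rep, mk_rep] at this
      exact Subtype.ext this
    · intro x _
      rw [dvd_iff_isRoot, IsRoot.def, eval_sub, eval_mul, eval_C, eval_map_algebraMap,
        eval_map_algebraMap, ← hQ.subst_eq (A := rep (x : PGL(2, F))) (by simp),
        div_mul_cancel₀, sub_self]
      intro h0
      exact hQ.ne_zero (transcendental_iff.mp (transcendental_mobius _) _ h0)
  · rw [hd, natDegree_prod_of_monic _ _ fun x _ => monic_X_sub_C _]
    simp [Nat.card_eq_fintype_card]

/-- The equation of the fibre of `g / h` through a point, with denominators cleared. -/
theorem IsQuotientMap.fibre_cleared [Fintype G] (hQ : IsQuotientMap G g h) (α : K) :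
    C (∏ x : G, den (rep (x : PGL(2, F))) α) *
      (C (aeval α h) * g.map (algebraMap F K) - C (aeval α g) * h.map (algebraMap F K)) =
    C (aeval α h) * ∏ x : G, (C (den (rep (x : PGL(2, F))) α) * X -
      C (algebraMap F K (rep (x : PGL(2, F)) 0 0) * α +
        algebraMap F K (rep (x : PGL(2, F)) 0 1))) := by
  let dn : G → F[X] := fun x => C (rep (x : PGL(2, F)) 1 0) * X + C (rep (x : PGL(2, F)) 1 1)
  let nm : G → F[X] := fun x => C (rep (x : PGL(2, F)) 0 0) * X + C (rep (x : PGL(2, F)) 0 1)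
  -- With all denominators cleared, the generic identity holds in F[x][Y], so x can be specialised
  -- to any α, including poles.
  have key : C (∏ x, dn x) * (C h * g.map C - C g * h.map C) =
      C h * ∏ x, (C (dn x) * X - C (nm x)) := by
    apply map_injective (algebraMap F[X] (RatFunc F)) (FaithfulSMul.algebraMap_injective _ _)
    have hC : (algebraMap F[X] (RatFunc F)).comp C = algebraMap F (RatFunc F) := by
      ext c
      simp
    have hd : ∀ x, algebraMap F[X] (RatFunc F) (dn x) =
        den (rep (x : PGL(2, F))) RatFunc.X := fun x => by simp [dn, den]
    have hn : ∀ x, algebraMap F[X] (RatFunc F) (nm x) =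
        den (rep (x : PGL(2, F))) RatFunc.X * mobius (rep (x : PGL(2, F))) := fun x => by
      rw [mobius_eq_mob, mob, mul_div_cancel₀ _ (den_X_ne_zero _)]
      simp [nm]
    have hh : algebraMap F[X] (RatFunc F) h ≠ 0 := by
      simpa using hQ.ne_zero
    simp only [Polynomial.map_mul, Polynomial.map_sub, map_C, Polynomial.map_prod, map_X, map_map,
      hC, map_prod, hd, hn]
    have e : ∀ x : G, C (den (rep (x : PGL(2, F))) (RatFunc.X : RatFunc F)) * X -
        C (den (rep (x : PGL(2, F))) (RatFunc.X : RatFunc F) * mobius (rep (x : PGL(2, F)))) =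
        C (den (rep (x : PGL(2, F))) (RatFunc.X : RatFunc F)) *
          (X - C (mobius (rep (x : PGL(2, F))))) := fun x => by rw [C_mul]; ring
    simp only [e]
    rw [Finset.prod_mul_distrib, ← hQ.generic_fibre]
    have e2 : C (algebraMap F[X] (RatFunc F) g) = C (algebraMap F[X] (RatFunc F) h) *
        C (algebraMap F[X] (RatFunc F) g / algebraMap F[X] (RatFunc F) h) := by
      rw [← C_mul, mul_div_cancel₀ _ hh]
    rw [e2]
    ring
  have hC : ((aeval α : F[X] →ₐ[F] K) : F[X] →+* K).comp C = algebraMap F K := by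
    ext c
    simp
  have := congrArg (Polynomial.map ((aeval α : F[X] →ₐ[F] K) : F[X] →+* K)) key
  simp only [Polynomial.map_mul, Polynomial.map_sub, map_C, Polynomial.map_prod, map_X, map_map,
      hC, map_prod, RingHom.coe_coe, dn, nm, aeval_num, aeval_den] at this
  rw [map_prod]
  exact this

/-- The poles of Q are exactly the preimages of ∞ under `G`, read off from the cleared equation. If
some `den` vanishes at α, the left side is zero; a factor on the right cannot be the zero
polynomial, since its matrix would be singular, so h(α) = 0. If h(α) = 0 at a regular α, the
equation forces g(α) = 0, against coprimality. -/
theorem IsQuotientMap.aeval_denom_ne_zero_iff [Finite G] (hQ : IsQuotientMap G g h) {α : K} :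
    aeval α h ≠ 0 ↔ α ∈ regularPoints K G := by
  have := Fintype.ofFinite G
  have key := hQ.fibre_cleared α
  constructor
  · intro hα A hA h0
    have h1 : den (rep (Matrix.ProjGenLinGroup.mk A)) α = 0 := by
      by_contra hne
      exact den_congr (mk_rep _) hne h0
    have h2 : ∏ x : G, den (rep (x : PGL(2, F))) α = 0 :=
      Finset.prod_eq_zero (Finset.mem_univ ⟨_, hA⟩) h1
    rw [h2, C_0, zero_mul, eq_comm, mul_eq_zero, Finset.prod_eq_zero_iff] at key
    rcases key with h3 | ⟨x, -, h3⟩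
    · exact hα (C_eq_zero.mp h3)
    · have h4 := congrArg (coeff · 0) h3
      have h5 := congrArg (coeff · 1) h3
      simp [coeff_C, -map_add, -map_mul] at h4 h5
      set M := rep (x : PGL(2, F))
      have h6 : algebraMap F K (M 0 0 * M 1 1 - M 0 1 * M 1 0) = 0 := by
        rw [den] at h5
        simp only [map_sub, map_mul]
        linear_combination algebraMap F K (M 0 0) * h5 + algebraMap F K (M 1 0) * h4
      exact entries_det_ne_zero M (by simpa [-map_sub, -map_mul] using h6)
  · intro hα h0
    have h2 : ∏ x : G, den (rep (x : PGL(2, F))) α ≠ 0 :=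
      Finset.prod_ne_zero_iff.mpr fun x _ => hα _ (by simp)
    rw [h0, C_0, zero_mul, zero_mul, zero_sub, mul_eq_zero, neg_eq_zero, mul_eq_zero] at key
    rcases key with h3 | h3 | h3
    · exact h2 (C_eq_zero.mp h3)
    · obtain ⟨u, v, huv⟩ := hQ.coprime
      have := congrArg (aeval α) huv
      simp [h0, C_eq_zero.mp h3] at this
    · exact hQ.ne_zero ((Polynomial.map_eq_zero _).mp h3)

theorem IsQuotientMap.fibre [Fintype G] (hQ : IsQuotientMap G g h) {α : K}
    (hα : α ∈ regularPoints K G) :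
    g.map (algebraMap F K) - C (aeval α g / aeval α h) * h.map (algebraMap F K) =
      ∏ x : G, (X - C (mob (rep (x : PGL(2, F))) α)) := by
  have key := hQ.fibre_cleared α
  have hh := hQ.aeval_denom_ne_zero_iff.mpr hα
  have h2 : ∏ x : G, den (rep (x : PGL(2, F))) α ≠ 0 :=
    Finset.prod_ne_zero_iff.mpr fun x _ => hα _ (by simp)
  have e : ∀ x : G, C (den (rep (x : PGL(2, F))) α) * X -
      C (algebraMap F K (rep (x : PGL(2, F)) 0 0) * α +
        algebraMap F K (rep (x : PGL(2, F)) 0 1)) =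
      C (den (rep (x : PGL(2, F))) α) * (X - C (mob (rep (x : PGL(2, F))) α)) := fun x => by
    have : den (rep (x : PGL(2, F))) α ≠ 0 := hα _ (by simp)
    rw [mul_sub, ← C_mul, mob, mul_div_cancel₀ _ this]
  simp only [e] at key
  rw [Finset.prod_mul_distrib, map_prod] at key
  have h3 : ∏ x : G, (C (den (rep (x : PGL(2, F))) α)) ≠ 0 := by
    rw [← map_prod]
    exact C_ne_zero.mpr h2
  have e2 : C (aeval α g) = C (aeval α h) * C (aeval α g / aeval α h) := by
    rw [← C_mul, mul_div_cancel₀ _ hh]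
  rw [e2] at key
  apply mul_left_cancel₀ h3
  apply mul_left_cancel₀ (C_ne_zero.mpr hh)
  linear_combination key

end Fibres

/-! ### The group action on regular points and its commutation with Galois -/

section OrbitAction

variable {F : Type*} [Field F] {K : Type*} [Field K] [Algebra F K] {G : Subgroup PGL(2, F)}

noncomputable instance : MulAction G (regularPoints K G) where
  smul x α := ⟨mob (rep (x : PGL(2, F))) (α : K), mob_mem_regularPoints α.2 (by simp)⟩
  one_smul α := Subtype.ext (by
    change mob (rep ((1 : G) : PGL(2, F))) (α : K) = α
    rw [mob_congr (B := 1) (by simp), mob_one])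
  mul_smul x y α := Subtype.ext (by
    change mob (rep ((x * y : G) : PGL(2, F))) (α : K) =
      mob (rep (x : PGL(2, F))) (mob (rep (y : PGL(2, F))) (α : K))
    rw [← mob_mul (α.2 _ (by simp))]
    exact mob_congr (by simp) _)

theorem coe_smul (x : G) (α : regularPoints K G) :
    ((x • α : regularPoints K G) : K) = mob (rep (x : PGL(2, F))) (α : K) := rfl

/-- Algebra automorphisms act on the regular points. -/
def galMap (τ : K ≃ₐ[F] K) (α : regularPoints K G) : regularPoints K G :=
  ⟨τ α, fun A hA h => α.2 A hA (by
    apply τ.injective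
    rw [map_zero, ← h]
    simp [den])⟩

theorem galMap_smul (τ : K ≃ₐ[F] K) (x : G) (α : regularPoints K G) :
    galMap τ (x • α) = x • galMap τ α :=
  Subtype.ext (map_mob (τ : K →ₐ[F] K) _ _)

theorem galMap_injective (τ : K ≃ₐ[F] K) :
    Function.Injective (galMap τ : regularPoints K G → _) := fun _ _ h =>
  Subtype.ext (τ.injective (congrArg Subtype.val h))

/-- The matrices have entries in F, so Galois automorphisms commute with `G`. -/
theorem stabilizer_galMap (τ : K ≃ₐ[F] K) (α : regularPoints K G) :
    MulAction.stabilizer G (galMap τ α) = MulAction.stabilizer G α := by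
  ext x
  rw [MulAction.mem_stabilizer_iff, MulAction.mem_stabilizer_iff, ← galMap_smul,
    (galMap_injective τ).eq_iff]

theorem card_stabilizer_smul (x : G) (α : regularPoints K G) :
    Nat.card (MulAction.stabilizer G (x • α)) = Nat.card (MulAction.stabilizer G α) :=
  (Nat.card_congr (MulAction.stabilizerEquivStabilizer (a := α) (g := x) rfl).toEquiv).symm

variable [Algebra.IsAlgebraic F K]

theorem pglAct_minpoly (x : G) (α : regularPoints K G) :
    pglAct (x : PGL(2, F)) (minpoly F (α : K)) = minpoly F ((x⁻¹ • α : regularPoints K G) : K) := by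
  have h := glAct_minpoly_mob (rep (x : PGL(2, F)))
    (Algebra.IsIntegral.isIntegral (R := F) ((x⁻¹ • α : regularPoints K G) : K))
    ((x⁻¹ • α).2 _ (by simp))
  rw [← coe_smul, smul_inv_smul] at h
  rw [← h, ← pglAct_mk, mk_rep]

theorem orbit_minpoly (α : regularPoints K G) :
    orbit G (minpoly F (α : K)) =
      Set.range fun x : G => minpoly F ((x • α : regularPoints K G) : K) := by
  ext t
  constructor
  · rintro ⟨x, hx, rfl⟩
    exact ⟨(⟨x, hx⟩ : G)⁻¹, (pglAct_minpoly ⟨x, hx⟩ α).symm⟩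
  · rintro ⟨x, rfl⟩
    exact ⟨_, (x⁻¹).2, by rw [pglAct_minpoly, inv_inv]⟩

theorem finite_orbit [Finite G] (r : F[X]) : (orbit G r).Finite := by
  have : orbit G r = Set.range fun x : G => pglAct (x : PGL(2, F)) r := by
    ext t
    simp [orbit]
  rw [this]
  exact Set.finite_range _

end OrbitAction

/-! ### Degrees, roots and multiplicities of the transform -/

section Multiplicities

variable {F : Type*} [Field F]

theorem algebraMap_ratTransform (g f : F[X]) {h : F[X]} (hh : h ≠ 0) :
    algebraMap F[X] (RatFunc F) (ratTransform g h f) =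
      algebraMap F[X] (RatFunc F) h ^ f.natDegree *
        aeval (algebraMap F[X] (RatFunc F) g / algebraMap F[X] (RatFunc F) h) f := by
  have := aeval_ratTransform g h f (α := (RatFunc.X : RatFunc F))
    (by rwa [RatFunc.aeval_X_left_eq_algebraMap, ne_eq, FaithfulSMul.algebraMap_eq_zero_iff])
  simpa only [RatFunc.aeval_X_left_eq_algebraMap] using this

theorem ratTransform_mul (g : F[X]) {h : F[X]} (hh : h ≠ 0) {p q : F[X]} (hp : p ≠ 0)
    (hq : q ≠ 0) : ratTransform g h (p * q) = ratTransform g h p * ratTransform g h q := by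
  apply FaithfulSMul.algebraMap_injective F[X] (RatFunc F)
  rw [map_mul, algebraMap_ratTransform _ _ hh, algebraMap_ratTransform _ _ hh,
    algebraMap_ratTransform _ _ hh, natDegree_mul hp hq, map_mul]
  ring

theorem ratTransform_X_sub_C (g h : F[X]) (β : F) : ratTransform g h (X - C β) = g - C β * h := by
  rw [ratTransform, natDegree_X_sub_C]
  simp [Finset.sum_range_succ, coeff_X, coeff_C]
  ring

theorem ratTransform_map {K : Type*} [Field K] (i : F →+* K) (g h f : F[X]) :
    (ratTransform g h f).map i = ratTransform (g.map i) (h.map i) (f.map i) := by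
  simp [ratTransform, Polynomial.map_sum, natDegree_map]

/-- Since deg h < deg g, the term g^deg f strictly dominates all others. -/
theorem monic_ratTransform {g h f : F[X]} (hg : g.Monic) (hlt : h.natDegree < g.natDegree)
    (hf : f.Monic) : (ratTransform g h f).Monic ∧
      (ratTransform g h f).natDegree = f.natDegree * g.natDegree := by
  rw [ratTransform, Finset.sum_range_succ, hf.coeff_natDegree, C_1, one_mul, Nat.sub_self,
    pow_zero, mul_one]
  rcases Nat.eq_zero_or_pos f.natDegree with h0 | h0
  · simp [h0]
  have hgn : (g ^ f.natDegree).natDegree = f.natDegree * g.natDegree := hg.natDegree_pow _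
  have hpos : 0 < f.natDegree * g.natDegree := Nat.mul_pos h0 (by omega)
  have key : (∑ i ∈ Finset.range f.natDegree, C (f.coeff i) * g ^ i *
      h ^ (f.natDegree - i)).natDegree < (g ^ f.natDegree).natDegree := by
    rw [hgn, ← Nat.le_sub_one_iff_lt hpos]
    refine natDegree_sum_le_of_forall_le _ _ fun i hi => ?_
    have hi' := Finset.mem_range.mp hi
    rw [Nat.le_sub_one_iff_lt hpos]
    obtain ⟨j, hj⟩ := Nat.exists_eq_add_of_lt hi'
    have hsub : f.natDegree - i = j + 1 := by omega
    rw [hsub]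
    calc (C (f.coeff i) * g ^ i * h ^ (j + 1)).natDegree
        ≤ 0 + i * g.natDegree + (j + 1) * h.natDegree :=
          natDegree_mul_le_of_le (natDegree_mul_le_of_le (natDegree_C _).le
            (natDegree_pow_le_of_le _ le_rfl)) (natDegree_pow_le_of_le _ le_rfl)
      _ < 0 + i * g.natDegree + (j + 1) * g.natDegree := by
          have := Nat.mul_lt_mul_of_pos_left hlt (Nat.succ_pos j)
          simpa using this
      _ = f.natDegree * g.natDegree := by rw [hj]; ring
  rw [add_comm]
  refine ⟨(hg.pow _).add_of_left (degree_lt_degree key), ?_⟩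
  rw [natDegree_add_eq_left_of_natDegree_lt key, hgn]

variable {K : Type*} [Field K] [Algebra F K] {G : Subgroup PGL(2, F)} {g h : F[X]}

theorem IsQuotientMap.aeval_denom_ne_zero [Finite G] (hQ : IsQuotientMap G g h)
    (α : regularPoints K G) : aeval (α : K) h ≠ 0 :=
  hQ.aeval_denom_ne_zero_iff.mpr α.2

/-- At a zero of h the transform takes the value g(γ)^deg f, which is nonzero by coprimality; so
roots are automatically regular. -/
theorem IsQuotientMap.root_iff [Finite G] (hQ : IsQuotientMap G g h) {f : F[X]} (hf : f.Monic)
    (γ : K) : aeval γ (ratTransform g h f) = 0 ↔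
      γ ∈ regularPoints K G ∧ aeval (aeval γ g / aeval γ h) f = 0 := by
  by_cases hγ : aeval γ h = 0
  · have : γ ∉ regularPoints K G := fun h' => hQ.aeval_denom_ne_zero_iff.mpr h' hγ
    simp only [this, false_and, iff_false]
    rw [aeval_ratTransform_of_eq_zero _ _ hf hγ]
    refine pow_ne_zero _ fun h0 => ?_
    obtain ⟨u, v, huv⟩ := hQ.coprime
    have := congrArg (aeval γ) huv
    simp [h0, hγ] at this
  · have h' := hQ.aeval_denom_ne_zero_iff.mp hγ
    rw [aeval_ratTransform _ _ _ hγ, mul_eq_zero]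
    simp [h', hγ]

/-- In the product over `G`, the factor X - α occurs once for each element fixing α. -/
theorem IsQuotientMap.rootMultiplicity_fibre [Finite G] (hQ : IsQuotientMap G g h)
    (α : regularPoints K G) :
    rootMultiplicity (α : K) (g.map (algebraMap F K) -
      C (aeval (α : K) g / aeval (α : K) h) * h.map (algebraMap F K)) =
    Nat.card (MulAction.stabilizer G α) := by
  classical
  have := Fintype.ofFinite G
  rw [hQ.fibre α.2, ← count_roots]
  have e : (∏ x : G, (X - C (mob (rep (x : PGL(2, F))) (α : K)))) =
      ((Finset.univ.val.map fun x : G => mob (rep (x : PGL(2, F))) (α : K)).map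
        fun a => X - C a).prod := by
    rw [Multiset.map_map]
    rfl
  rw [e, roots_multiset_prod_X_sub_C, Multiset.count_map]
  have e2 : Nat.card (MulAction.stabilizer G α) =
      (Finset.univ.filter fun x : G => (α : K) = mob (rep (x : PGL(2, F))) (α : K)).card := by
    rw [← Fintype.card_subtype, ← Nat.card_eq_fintype_card]
    refine Nat.card_congr (Equiv.subtypeEquivRight fun x => ?_)
    rw [MulAction.mem_stabilizer_iff, Subtype.ext_iff, coe_smul, eq_comm]
  rw [e2]
  rfl

/-- By separability f = (X - β)q with q(β) ≠ 0, where β = Q(α). The transform is then (g - βh) times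
that of q, and the latter does not vanish at α. -/
theorem IsQuotientMap.rootMultiplicity_ratTransform [Finite G] (hQ : IsQuotientMap G g h)
    {f : F[X]} (hf : f.Separable) (α : regularPoints K G)
    (hfα : aeval (aeval (α : K) g / aeval (α : K) h) f = 0) :
    rootMultiplicity (α : K) ((ratTransform g h f).map (algebraMap F K)) =
      Nat.card (MulAction.stabilizer G α) := by
  rw [← hQ.rootMultiplicity_fibre α]
  set β := aeval (α : K) g / aeval (α : K) h with hβ
  have hh := hQ.aeval_denom_ne_zero α
  have hf0 : f.map (algebraMap F K) ≠ 0 := (Polynomial.map_ne_zero_iff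
    (algebraMap F K).injective).mpr hf.ne_zero
  have hr : IsRoot (f.map (algebraMap F K)) β := by
    rw [IsRoot.def, eval_map_algebraMap, hfα]
  obtain ⟨q, hq⟩ := dvd_iff_isRoot.mpr hr
  have hq0 : q ≠ 0 := by
    rintro rfl
    exact hf0 (by rw [hq, mul_zero])
  have hqβ : aeval β q ≠ 0 := by
    intro h0
    have h1 : 1 < rootMultiplicity β (f.map (algebraMap F K)) := by
      rw [hq, rootMultiplicity_mul (hq ▸ hf0), rootMultiplicity_X_sub_C_self]
      have : 0 < rootMultiplicity β q := (rootMultiplicity_pos hq0).mpr (by simpa using h0)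
      omega
    exact absurd (rootMultiplicity_le_one_of_separable (hf.map (f := algebraMap F K)) β)
      (not_le.mpr h1)
  have hhm : h.map (algebraMap F K) ≠ 0 := (Polynomial.map_ne_zero_iff
    (algebraMap F K).injective).mpr hQ.ne_zero
  rw [ratTransform_map, hq, ratTransform_mul _ hhm (X_sub_C_ne_zero β) hq0, ratTransform_X_sub_C]
  have hne : aeval (α : K) (ratTransform (g.map (algebraMap F K)) (h.map (algebraMap F K)) q)
      ≠ 0 := by
    have e1 : ∀ p : F[X], aeval (α : K) (p.map (algebraMap F K)) = aeval (α : K) p := fun p => by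
      simp
    rw [aeval_ratTransform _ _ _ (by rwa [e1]), e1, e1]
    exact mul_ne_zero (pow_ne_zero _ hh) hqβ
  rw [rootMultiplicity_mul, rootMultiplicity_eq_zero (p := ratTransform _ _ q), add_zero]
  · simpa using hne
  · refine mul_ne_zero (hQ.monic_sub β).1.ne_zero ?_
    intro h0
    rw [h0, map_zero] at hne
    exact hne rfl

end Multiplicities

/-! ### The transform as a power of an orbit polynomial -/

section OrbitPolynomial

theorem isCoprime_of_monic_irreducible {F : Type*} [Field F] {p q : F[X]} (hp : p.Monic)
    (hq : q.Monic) (hpi : Irreducible p) (hqi : Irreducible q) (h : p ≠ q) : IsCoprime p q :=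
  (hpi.coprime_iff_not_dvd).mpr fun hd =>
    h (eq_of_monic_of_associated hp hq (hpi.associated_of_dvd hqi hd))

theorem eq_of_rootMultiplicity_eq {F K : Type*} [Field F] [Field K] [Algebra F K] [IsAlgClosed K]
    {p q : F[X]} (hp : p.Monic) (hq : q.Monic)
    (h : ∀ γ : K, rootMultiplicity γ (p.map (algebraMap F K)) =
      rootMultiplicity γ (q.map (algebraMap F K))) : p = q := by
  classical
  apply map_injective _ (algebraMap F K).injective
  rw [(IsAlgClosed.splits (p.map (algebraMap F K))).eq_prod_roots_of_monic (hp.map _),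
    (IsAlgClosed.splits (q.map (algebraMap F K))).eq_prod_roots_of_monic (hq.map _)]
  have : (p.map (algebraMap F K)).roots = (q.map (algebraMap F K)).roots :=
    Multiset.ext.mpr fun γ => by rw [count_roots, count_roots, h]
  rw [this]

variable {F : Type*} [Field F] {G : Subgroup PGL(2, F)} {K : Type*} [Field K] [Algebra F K]

/-- The product of the members of `G ∗ r`. -/
noncomputable def orbitPoly (G : Subgroup PGL(2, F)) (r : F[X]) : F[X] := ∏ᶠ t ∈ orbit G r, t

theorem orbitPoly_eq [Finite G] (r : F[X]) :
    orbitPoly G r = ∏ t ∈ (finite_orbit (G := G) r).toFinset, t :=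
  finprod_mem_eq_finite_toFinset_prod _ _

section

variable [Algebra.IsAlgebraic F K]

theorem natDegree_smul (x : G) (α : regularPoints K G) :
    (minpoly F ((x • α : regularPoints K G) : K)).natDegree = (minpoly F (α : K)).natDegree := by
  rw [coe_smul]
  exact natDegree_minpoly_mob _ (Algebra.IsIntegral.isIntegral _) (α.2 _ (by simp))

theorem mem_orbit_minpoly {α : regularPoints K G} {t : F[X]} (ht : t ∈ orbit G (minpoly F (α : K))) :
    t.Monic ∧ Irreducible t ∧ t.natDegree = (minpoly F (α : K)).natDegree := by
  rw [orbit_minpoly] at ht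
  obtain ⟨x, rfl⟩ := ht
  have : IsIntegral F ((x • α : regularPoints K G) : K) := Algebra.IsIntegral.isIntegral _
  exact ⟨minpoly.monic this, minpoly.irreducible this, natDegree_smul x α⟩

theorem minpoly_mem_orbit (α : regularPoints K G) :
    minpoly F (α : K) ∈ orbit G (minpoly F (α : K)) := by
  rw [orbit_minpoly]
  exact ⟨1, by simp only [one_smul]⟩

theorem monic_orbitPoly [Finite G] (α : regularPoints K G) :
    (orbitPoly G (minpoly F (α : K))).Monic := by
  rw [orbitPoly_eq]
  exact monic_prod_of_monic _ _ fun t ht =>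
    (mem_orbit_minpoly ((Set.Finite.mem_toFinset _).mp ht)).1

theorem natDegree_orbitPoly [Finite G] (α : regularPoints K G) :
    (orbitPoly G (minpoly F (α : K))).natDegree =
      (orbit G (minpoly F (α : K))).ncard * (minpoly F (α : K)).natDegree := by
  rw [orbitPoly_eq, natDegree_prod_of_monic _ _ fun t ht =>
    (mem_orbit_minpoly ((Set.Finite.mem_toFinset _).mp ht)).1, Finset.sum_congr rfl fun t ht =>
    (mem_orbit_minpoly ((Set.Finite.mem_toFinset _).mp ht)).2.2, Finset.sum_const, smul_eq_mul,
    Set.ncard_eq_toFinset_card _ (finite_orbit _)]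

theorem separable_orbitPoly [Finite G] [PerfectField F] (α : regularPoints K G) :
    (orbitPoly G (minpoly F (α : K))).Separable := by
  rw [orbitPoly_eq]
  refine separable_prod' (fun t ht u hu htu => ?_) fun t ht => ?_
  · have ht' := mem_orbit_minpoly ((Set.Finite.mem_toFinset _).mp ht)
    have hu' := mem_orbit_minpoly ((Set.Finite.mem_toFinset _).mp hu)
    exact isCoprime_of_monic_irreducible ht'.1 hu'.1 ht'.2.1 hu'.2.1 htu
  · exact PerfectField.separable_of_irreducible
      (mem_orbit_minpoly ((Set.Finite.mem_toFinset _).mp ht)).2.1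

theorem aeval_orbitPoly_eq_zero_iff [Finite G] (α : regularPoints K G) (γ : K) :
    aeval γ (orbitPoly G (minpoly F (α : K))) = 0 ↔
      ∃ x : G, aeval γ (minpoly F ((x • α : regularPoints K G) : K)) = 0 := by
  rw [orbitPoly_eq, map_prod, Finset.prod_eq_zero_iff]
  simp [orbit_minpoly]

end

theorem natDegree_pos_orbitPoly [Finite G] [Algebra.IsAlgebraic F K] (α : regularPoints K G) :
    0 < (orbitPoly G (minpoly F (α : K))).natDegree := by
  rw [natDegree_orbitPoly]
  refine Nat.mul_pos ?_ (minpoly.natDegree_pos (Algebra.IsIntegral.isIntegral _))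
  exact (Set.ncard_pos (finite_orbit _)).mpr ⟨_, minpoly_mem_orbit α⟩

variable {g h : F[X]}

theorem aeval_apply_algEquiv (τ : K ≃ₐ[F] K) (p : F[X]) (α : K) : aeval (τ α) p = τ (aeval α p) :=
  aeval_algHom_apply (τ : K →ₐ[F] K) α p

theorem IsQuotientMap.exists_smul_eq [Finite G] (hQ : IsQuotientMap G g h)
    {α γ : regularPoints K G}
    (e : aeval (γ : K) g / aeval (γ : K) h = aeval (α : K) g / aeval (α : K) h) :
    ∃ x : G, x • α = γ := by
  have := Fintype.ofFinite G
  have h1 := congrArg (eval (γ : K)) (hQ.fibre α.2)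
  have hh := hQ.aeval_denom_ne_zero γ
  rw [← e, eval_sub, eval_mul, eval_C, eval_map_algebraMap, eval_map_algebraMap,
    div_mul_cancel₀ _ hh, sub_self, eval_prod, eq_comm (a := (0 : K)), Finset.prod_eq_zero_iff] at h1
  obtain ⟨x, -, hx⟩ := h1
  refine ⟨x, Subtype.ext ?_⟩
  rw [coe_smul]
  rw [eval_sub, eval_X, eval_C, sub_eq_zero] at hx
  exact hx.symm

theorem IsQuotientMap.quot_smul [Finite G] (hQ : IsQuotientMap G g h) (x : G)
    (α : regularPoints K G) :
    aeval ((x • α : regularPoints K G) : K) g / aeval ((x • α : regularPoints K G) : K) h =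
      aeval (α : K) g / aeval (α : K) h := by
  have := Fintype.ofFinite G
  have h1 := congrArg (eval ((x • α : regularPoints K G) : K)) (hQ.fibre α.2)
  have hh := hQ.aeval_denom_ne_zero (x • α)
  rw [eval_sub, eval_mul, eval_C, eval_map_algebraMap, eval_map_algebraMap, eval_prod,
    Finset.prod_eq_zero (Finset.mem_univ x) (by simp [coe_smul]), sub_eq_zero] at h1
  rw [h1, mul_div_cancel_right₀ _ hh]

variable [IsAlgClosed K] [Normal F K]

/-- If `f` is irreducible and vanishes at the image of `α` under the quotient map, then its
transform is a power of the orbit polynomial of the minimal polynomial of `α`, and the exponent is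
the order of the stabilizer of `α`. -/
theorem IsQuotientMap.ratTransform_eq_pow [Finite G] [PerfectField F] (hQ : IsQuotientMap G g h)
    {f : F[X]} (hf : f.Monic) (hfi : Irreducible f) (α : regularPoints K G)
    (hfα : aeval (aeval (α : K) g / aeval (α : K) h) f = 0) :
    ratTransform g h f =
      orbitPoly G (minpoly F (α : K)) ^ Nat.card (MulAction.stabilizer G α) := by
  classical
  have hm := (monic_ratTransform hQ.monic hQ.natDegree_lt hf).1
  have hO := monic_orbitPoly α
  have hfm := minpoly.eq_of_irreducible_of_monic hfi hfα hf
  refine eq_of_rootMultiplicity_eq (K := K) hm (hO.pow _) fun γ => ?_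
  rw [Polynomial.map_pow, ← count_roots (p := _ ^ _), roots_pow, Multiset.count_nsmul,
    count_roots]
  by_cases hγ : aeval γ (orbitPoly G (minpoly F (α : K))) = 0
  · have h1 : rootMultiplicity γ ((orbitPoly G (minpoly F (α : K))).map (algebraMap F K)) = 1 := by
      apply le_antisymm
      · exact rootMultiplicity_le_one_of_separable (separable_orbitPoly α).map γ
      · refine (rootMultiplicity_pos (hO.map _).ne_zero).mpr ?_
        rw [IsRoot.def, eval_map_algebraMap, hγ]
    rw [h1, mul_one]
    obtain ⟨x, hx⟩ := (aeval_orbitPoly_eq_zero_iff α γ).mp hγ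
    -- Every root of the orbit polynomial is a Galois conjugate of a `G`-translate of α, so its
    -- stabilizer has the same order as that of α.
    obtain ⟨τ, hτ⟩ := minpoly.exists_algEquiv_of_root'
      (Algebra.IsAlgebraic.isAlgebraic ((x • α : regularPoints K G) : K)) hx
    have hγ' : γ = (galMap τ (x • α) : regularPoints K G) := hτ.symm
    rw [hγ', hQ.rootMultiplicity_ratTransform (PerfectField.separable_of_irreducible hfi),
      stabilizer_galMap, card_stabilizer_smul]
    change aeval (aeval (τ ((x • α : regularPoints K G) : K)) g /
      aeval (τ ((x • α : regularPoints K G) : K)) h) f = 0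
    rw [aeval_apply_algEquiv, aeval_apply_algEquiv, ← map_div₀, aeval_apply_algEquiv,
      hQ.quot_smul, hfα, map_zero]
  · have h1 : rootMultiplicity γ ((orbitPoly G (minpoly F (α : K))).map (algebraMap F K)) = 0 :=
      rootMultiplicity_eq_zero (by rwa [IsRoot.def, eval_map_algebraMap])
    rw [h1, mul_zero]
    refine rootMultiplicity_eq_zero ?_
    rw [IsRoot.def, eval_map_algebraMap, hQ.root_iff hf]
    rintro ⟨hr, hfγ⟩
    refine hγ ((aeval_orbitPoly_eq_zero_iff α γ).mpr ?_)
    rw [hfm] at hfγ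
    -- Q(γ) is conjugate to Q(α). Hence γ lies in the fibre through a conjugate of α, that is, in
    -- its `G`-orbit.
    obtain ⟨τ, hτ⟩ := minpoly.exists_algEquiv_of_root' (Algebra.IsAlgebraic.isAlgebraic _) hfγ
    obtain ⟨x, hx⟩ := hQ.exists_smul_eq (α := galMap τ α) (γ := ⟨γ, hr⟩) (by
      change _ = aeval (τ (α : K)) g / aeval (τ (α : K)) h
      rw [aeval_apply_algEquiv, aeval_apply_algEquiv, ← map_div₀ τ, hτ])
    refine ⟨x, ?_⟩
    rw [← galMap_smul] at hx
    have hx' : τ ((x • α : regularPoints K G) : K) = γ := congrArg Subtype.val hx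
    rw [← hx', aeval_apply_algEquiv, minpoly.aeval, map_zero]

end OrbitPolynomial

/-! ### Degrees of nonregular points, fixed points and their images -/

section Degrees

variable {F : Type*} [Field F] {G : Subgroup PGL(2, F)} {g h : F[X]}
  {K : Type*} [Field K] [Algebra F K]

theorem den_eq_zero {A : GL (Fin 2) F} {α : K} (h0 : den A α = 0) :
    A 1 0 ≠ 0 ∧ algebraMap F K (-(A 1 1) / A 1 0) = α := by
  have hc : A 1 0 ≠ 0 := by
    intro hc
    have hd : A 1 1 = 0 := by simpa [den, hc] using h0
    exact entries_det_ne_zero A (by rw [hc, hd]; ring)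
  refine ⟨hc, ?_⟩
  have hc' : algebraMap F K (A 1 0) ≠ 0 := by simpa using hc
  rw [map_div₀, map_neg, div_eq_iff hc']
  rw [den] at h0
  linear_combination -h0

theorem natDegree_minpoly_of_notMem {α : K} (hα : α ∉ regularPoints K G) :
    (minpoly F α).natDegree = 1 ∧
      ∃ A : GL (Fin 2) F, Matrix.ProjGenLinGroup.mk A ∈ G ∧ A 1 0 ≠ 0 := by
  simp only [regularPoints, Set.mem_ofPred_eq, not_forall, not_not] at hα
  obtain ⟨A, hA, h0⟩ := hα
  obtain ⟨hc, rfl⟩ := den_eq_zero h0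
  refine ⟨?_, A, hA, hc⟩
  rw [minpoly.eq_X_sub_C, natDegree_X_sub_C]

theorem minpoly_mem_nonRoot_iff {α : K} (hα : IsIntegral F α) :
    minpoly F α ∈ nonRoot G ↔ α ∈ regularPoints K G := by
  classical
  constructor
  · rintro ⟨-, hr⟩ A hA h0
    obtain ⟨hc, e⟩ := den_eq_zero h0
    refine hr A⁻¹ (by rw [map_inv]; exact inv_mem hA) (-(A 1 1) / A 1 0) ?_ ?_
    · rw [inv_smul_eq_iff, OnePoint.smul_some_eq_ite, if_pos]
      field_simp
      ring
    · rw [← e, minpoly.eq_X_sub_C]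
      simp
  · intro hr
    refine ⟨minpoly.monic hα, fun A hA β hβ h0 => ?_⟩
    have e := minpoly.root hα h0
    have h1 : A⁻¹ • ((β : F) : OnePoint F) = OnePoint.infty := by
      rw [inv_smul_eq_iff]
      convert hβ.symm
    rw [OnePoint.smul_some_eq_ite] at h1
    split_ifs at h1 with h2
    · refine hr A⁻¹ (by rw [map_inv]; exact inv_mem hA) ?_
      rw [← e, den, ← map_mul, ← map_add, h2, map_zero]
    · exact absurd h1 (OnePoint.coe_ne_infty _)

/-- A fixed point satisfies cα² + (d - a)α - b = 0, and this polynomial vanishes identically only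
for scalar matrices. -/
theorem natDegree_minpoly_le_two {x : PGL(2, F)} (hx : x ≠ 1) {α : K}
    (hd : den (rep x) α ≠ 0) (hα : mob (rep x) α = α) : (minpoly F α).natDegree ≤ 2 := by
  set M := rep x with hM
  set p : F[X] := C (M 1 0) * X ^ 2 + C (M 1 1 - M 0 0) * X + C (-(M 0 1)) with hp
  have h0 : p ≠ 0 := by
    intro hp0
    have h0 := congrArg (coeff · 0) hp0
    have h1 := congrArg (coeff · 1) hp0
    have h2 := congrArg (coeff · 2) hp0
    simp [hp, coeff_C, coeff_X, -map_sub] at h0 h1 h2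
    apply hx
    rw [← mk_rep x]
    refine mk_eq_of_mobius_eq (A := M) (B := 1) ?_
    have h3 : M 1 1 = M 0 0 := sub_eq_zero.mp h1
    have h4 : M 0 0 ≠ 0 := fun h => entries_det_ne_zero M (by rw [h, h2]; ring)
    have h5 : (RatFunc.C (M 0 0) : RatFunc F) ≠ 0 := by simpa using h4
    simp [mobius, h0, h2, h3, h5]
  have h1 : aeval α p = 0 := by
    rw [mob, div_eq_iff hd, den] at hα
    simp [hp]
    linear_combination -hα
  exact (natDegree_le_of_dvd (minpoly.dvd F α h1) h0).trans natDegree_quadratic_le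

theorem natDegree_minpoly_quot_le {α : K} (hα : IsIntegral F α) (g h : F[X]) :
    (minpoly F (aeval α g / aeval α h)).natDegree ≤ (minpoly F α).natDegree := by
  have hmem : ∀ p : F[X], aeval α p ∈ IntermediateField.adjoin F {α} := fun p =>
    IntermediateField.algebra_adjoin_le_adjoin F {α} (aeval_mem_adjoin_singleton F α)
  have : FiniteDimensional F (IntermediateField.adjoin F {α}) :=
    IntermediateField.adjoin.finiteDimensional hα
  rw [← IntermediateField.adjoin.finrank hα,
    ← IntermediateField.minpoly_eq (⟨_, div_mem (hmem g) (hmem h)⟩ :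
      IntermediateField.adjoin F {α})]
  exact minpoly.natDegree_le _

end Degrees

/-! ### Bounds for d(G) from above and below -/

section Bound

theorem exists_minpoly_eq {F : Type*} [Field F] {r : F[X]} (hr : r.Monic) (hri : Irreducible r) :
    ∃ α : AlgebraicClosure F, minpoly F α = r := by
  obtain ⟨α, hα⟩ := IsAlgClosed.exists_aeval_eq_zero (AlgebraicClosure F) r
    (degree_pos_of_irreducible hri).ne'
  exact ⟨α, (minpoly.eq_of_irreducible_of_monic hri hα hr).symm⟩

variable {F : Type*} [Field F] [PerfectField F] {G : Subgroup PGL(2, F)} [Finite G]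

/-- The exponent of the proper power is the order of a stabilizer, so a root α of r is fixed by a
nontrivial element and has degree at most 2; and Q(α), a root of f, lies in F(α). -/
theorem IsQuotientMap.natDegree_le_two {g h : F[X]} (hQ : IsQuotientMap G g h) {f : F[X]}
    (hf : f.Monic) (hfi : Irreducible f) (hp : IsProperPower G g h f) : f.natDegree ≤ 2 := by
  obtain ⟨r, hri, hr, k, hk, e⟩ := hp
  obtain ⟨α, rfl⟩ := exists_minpoly_eq hr.1 hri
  have hint : IsIntegral F α := Algebra.IsIntegral.isIntegral α
  have hα := (minpoly_mem_nonRoot_iff hint).mp hr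
  lift α to regularPoints (AlgebraicClosure F) G using hα
  change _ = orbitPoly G _ ^ k at e
  have h0 : aeval (α : AlgebraicClosure F) (ratTransform g h f) = 0 := by
    rw [e, map_pow, (aeval_orbitPoly_eq_zero_iff α _).mpr ⟨1, by rw [one_smul, minpoly.aeval]⟩,
      zero_pow (by omega)]
  have h1 := ((hQ.root_iff hf _).mp h0).2
  have e2 := hQ.ratTransform_eq_pow hf hfi α h1
  have hk2 : k = Nat.card (MulAction.stabilizer G α) := by
    have := congrArg natDegree (e.symm.trans e2)
    rw [natDegree_pow, natDegree_pow] at this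
    exact Nat.eq_of_mul_eq_mul_right (natDegree_pos_orbitPoly α) this
  have : MulAction.stabilizer G α ≠ ⊥ := by
    intro hb
    rw [hb, Subgroup.card_bot] at hk2
    omega
  obtain ⟨⟨x, hx⟩, hx1⟩ := Subgroup.ne_bot_iff_exists_ne_one.mp this
  have hfix : mob (rep ((x : G) : PGL(2, F))) (α : AlgebraicClosure F) = α := by
    rw [← coe_smul]
    exact congrArg Subtype.val hx
  rw [minpoly.eq_of_irreducible_of_monic hfi h1 hf]
  refine (natDegree_minpoly_quot_le hint g h).trans
    (natDegree_minpoly_le_two (x := ((x : G) : PGL(2, F))) ?_ (α.2 _ (by simp)) hfix)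
  simpa using hx1

/-- The bound 2 is essential here: `sSup` of an unbounded set of naturals would be 0. -/
theorem IsQuotientMap.natDegree_le_d {g h : F[X]} (hQ : IsQuotientMap G g h) {f : F[X]}
    (hf : f.Monic) (hfi : Irreducible f) (hp : IsProperPower G g h f) : f.natDegree ≤ d G := by
  refine le_csSup ⟨2, ?_⟩ ⟨g, h, hQ, f, ⟨hf, hfi, rfl⟩, hp⟩
  rintro _ ⟨g', h', hQ', f', ⟨hf', hfi', rfl⟩, hp'⟩
  exact hQ'.natDegree_le_two hf' hfi' hp'

/-- A ramified regular point gives a proper power. -/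
theorem IsQuotientMap.natDegree_le_d_of_stabilizer {g h : F[X]} (hQ : IsQuotientMap G g h)
    {f : F[X]} (hf : f.Monic) (hfi : Irreducible f)
    (α : regularPoints (AlgebraicClosure F) G)
    (hfα : aeval (aeval (α : AlgebraicClosure F) g / aeval (α : AlgebraicClosure F) h) f = 0)
    (hs : Nat.card (MulAction.stabilizer G α) ≠ 1) : f.natDegree ≤ d G := by
  have hint : IsIntegral F (α : AlgebraicClosure F) := Algebra.IsIntegral.isIntegral _
  refine hQ.natDegree_le_d hf hfi ⟨minpoly F (α : AlgebraicClosure F), minpoly.irreducible hint,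
    (minpoly_mem_nonRoot_iff hint).mpr α.2, _, ?_, hQ.ratTransform_eq_pow hf hfi α hfα⟩
  have : 0 < Nat.card (MulAction.stabilizer G α) := Nat.card_pos
  omega

theorem one_le_d {s : ℕ} (hs : s.Prime) (hcard : Nat.card G = s) {A : GL (Fin 2) F}
    (hA : Matrix.ProjGenLinGroup.mk A ∈ G) (hc : A 1 0 ≠ 0) : 1 ≤ d G := by
  obtain ⟨g, h, hQ⟩ := exists_isQuotientMap G
  -- The roots of this polynomial are the fixed points of A; as c ≠ 0, it has a root in the
  -- algebraic closure.
  set p : F[X] := C (A 1 0) * X ^ 2 + C (A 1 1 - A 0 0) * X + C (-(A 0 1)) with hp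
  obtain ⟨α, hα⟩ := IsAlgClosed.exists_aeval_eq_zero (AlgebraicClosure F) p
    (by rw [hp, degree_quadratic hc]; norm_num)
  simp [hp] at hα
  have hd : den A α ≠ 0 := by
    intro h0
    apply entries_det_ne_zero A
    apply (algebraMap F (AlgebraicClosure F)).injective
    rw [den] at h0
    simp only [map_sub, map_mul, map_zero]
    -- If cα + d = 0, the fixed-point equation gives aα + b = 0 as well, and A would be singular.
    linear_combination (algebraMap F (AlgebraicClosure F) (A 0 0) -
      algebraMap F (AlgebraicClosure F) (A 1 0) * α) * h0 +
      algebraMap F (AlgebraicClosure F) (A 1 0) * hα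
  have hfix : mob A α = α := by
    rw [mob, div_eq_iff hd, den]
    linear_combination -hα
  have hpow : ∀ n : ℕ, den (A ^ n) α ≠ 0 ∧ mob (A ^ n) α = α := by
    intro n
    induction n with
    | zero => simp
    | succ n ih =>
      rw [pow_succ, den_mul hd, mob_mul hd, hfix]
      exact ⟨mul_ne_zero ih.1 hd, ih.2⟩
  have hA1 : (⟨Matrix.ProjGenLinGroup.mk A, hA⟩ : G) ≠ 1 := by
    intro h1
    have h2 : Matrix.ProjGenLinGroup.mk (1 : GL (Fin 2) F) = Matrix.ProjGenLinGroup.mk A := by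
      rw [map_one]
      exact (congrArg Subtype.val h1).symm
    obtain ⟨u, -, hu⟩ := exists_eq_scalar_mul h2
    exact hc (by simp [hu])
  have := Fact.mk hs
  -- In a group of prime order the nontrivial class of A generates, so all of `G` fixes α.
  have hgen : ∀ B : GL (Fin 2) F, Matrix.ProjGenLinGroup.mk B ∈ G →
      ∃ n : ℕ, Matrix.ProjGenLinGroup.mk (A ^ n) = Matrix.ProjGenLinGroup.mk B := by
    intro B hB
    obtain ⟨n, hn⟩ := mem_powers_of_prime_card (g' := (⟨_, hB⟩ : G)) hcard hA1
    exact ⟨n, by simpa using congrArg Subtype.val hn⟩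
  have hreg : α ∈ regularPoints (AlgebraicClosure F) G := by
    intro B hB
    obtain ⟨n, hn⟩ := hgen B hB
    exact den_congr hn (hpow n).1
  lift α to regularPoints (AlgebraicClosure F) G using hreg
  have hstab : MulAction.stabilizer G α = ⊤ := by
    rw [eq_top_iff]
    intro x _
    rw [MulAction.mem_stabilizer_iff, Subtype.ext_iff, coe_smul]
    obtain ⟨n, hn⟩ := hgen (rep (x : PGL(2, F))) (by simp)
    rw [← mob_congr hn, (hpow n).2]
  have hint : IsIntegral F
      (aeval (α : AlgebraicClosure F) g / aeval (α : AlgebraicClosure F) h) :=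
    Algebra.IsIntegral.isIntegral _
  refine le_trans (minpoly.natDegree_pos hint) (hQ.natDegree_le_d_of_stabilizer
    (minpoly.monic hint) (minpoly.irreducible hint) α (minpoly.aeval _ _) ?_)
  rw [hstab, Subgroup.card_top, hcard]
  exact hs.ne_one

end Bound

/-! ### Orbit sizes and the factors of a transform -/

section Counting

variable {F : Type*} [Field F] {G : Subgroup PGL(2, F)}

theorem ncard_orbit_of_prime {K : Type*} [Field K] [Algebra F K] [Algebra.IsAlgebraic F K]
    {s : ℕ} (hs : s.Prime) (hcard : Nat.card G = s) (α : regularPoints K G) :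
    (orbit G (minpoly F (α : K))).ncard = s ∨ (orbit G (minpoly F (α : K))).ncard = 1 := by
  set r := minpoly F (α : K) with hr
  -- Substitution acts from the right, hence the order of the product.
  have hmul : ∀ x y : G, pglAct (y : PGL(2, F)) (pglAct (x : PGL(2, F)) r) =
      pglAct ((x * y : G) : PGL(2, F)) r := by
    intro x y
    rw [hr, pglAct_minpoly, pglAct_minpoly, pglAct_minpoly, mul_inv_rev, mul_smul]
  have hone : pglAct ((1 : G) : PGL(2, F)) r = r := by
    rw [hr, pglAct_minpoly, inv_one, one_smul]
  let H : Subgroup G :=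
    { carrier := {x | pglAct (x : PGL(2, F)) r = r}
      one_mem' := hone
      mul_mem' := by
        intro x y (hx : _ = r) (hy : _ = r)
        change _ = r
        rw [← hmul, hx, hy]
      inv_mem' := by
        intro x (hx : _ = r)
        change _ = r
        conv_lhs => rw [← hx, hmul, mul_inv_cancel, hone] }
  have hrange : orbit G r = Set.range fun x : G => pglAct (x : PGL(2, F)) r := by
    ext t
    simp [orbit]
  have := Fact.mk (hcard ▸ hs)
  -- The stabilizer of r is trivial or everything, as the order of `G` is prime.
  rcases H.eq_bot_or_eq_top_of_prime_card with hH | hH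
  · left
    have hinj : Function.Injective fun x : G => pglAct (x : PGL(2, F)) r := by
      intro x y hxy
      have h1 : x * y⁻¹ ∈ H := by
        change _ = r
        rw [← hmul]
        change pglAct _ ((fun x : G => pglAct (x : PGL(2, F)) r) x) = r
        rw [hxy]
        change pglAct _ (pglAct _ r) = r
        rw [hmul, mul_inv_cancel, hone]
      rwa [hH, Subgroup.mem_bot, mul_inv_eq_one] at h1
    rw [hrange, ← Set.image_univ, Set.ncard_image_of_injective _ hinj, Set.ncard_univ, hcard]
  · right
    rw [hrange, Set.ncard_eq_one]
    refine ⟨r, ?_⟩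
    ext t
    have h1 : ∀ x : G, pglAct (x : PGL(2, F)) r = r := fun x =>
      (hH ▸ Subgroup.mem_top x : x ∈ H)
    simp only [Set.mem_range, Set.mem_singleton_iff, h1, exists_const, eq_comm]

theorem finite_monicIrreducibles [Finite F] (n : ℕ) : (monicIrreducibles F n).Finite := by
  have : Finite (degreeLT F (n + 1)) := Module.finite_of_finite F
  refine ((degreeLT F (n + 1) : Submodule F F[X]) : Set F[X]).toFinite.subset ?_
  rintro f ⟨-, hf, hn⟩
  rw [SetLike.mem_coe, mem_degreeLT, degree_eq_natDegree hf.ne_zero, hn]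
  exact_mod_cast n.lt_succ_self

/-- The orbits of size `k` of monic irreducible polynomials of degree `n`. -/
def orbitsOfSize (G : Subgroup PGL(2, F)) (n k : ℕ) : Set (Set F[X]) :=
  {O | ∃ r ∈ monicIrreducibles F n, O = orbit G r ∧ O.ncard = k}

/-- The monic irreducible factors of the transform of `f`. -/
def transformFactors (g h f : F[X]) : Set F[X] :=
  {t | t.Monic ∧ Irreducible t ∧ t ∣ ratTransform g h f}

variable {K : Type*} [Field K] [Algebra F K] [IsAlgClosed K] [Normal F K] [Finite G]

theorem IsQuotientMap.transformFactors_eq [PerfectField F] {g h : F[X]}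
    (hQ : IsQuotientMap G g h) {f : F[X]} (hf : f.Monic) (hfi : Irreducible f)
    (α : regularPoints K G) (hfα : aeval (aeval (α : K) g / aeval (α : K) h) f = 0) :
    transformFactors g h f = orbit G (minpoly F (α : K)) := by
  have e := hQ.ratTransform_eq_pow hf hfi α hfα
  ext t
  constructor
  · rintro ⟨ht, hti, hd⟩
    rw [e] at hd
    have hd' := hti.prime.dvd_of_dvd_pow hd
    rw [orbitPoly_eq, hti.prime.dvd_finsetProd_iff] at hd'
    obtain ⟨u, hu, htu⟩ := hd'
    rw [Set.Finite.mem_toFinset] at hu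
    have hu' := mem_orbit_minpoly hu
    rwa [eq_of_monic_of_associated ht hu'.1 (hti.associated_of_dvd hu'.2.1 htu)]
  · intro ht
    have ht' := mem_orbit_minpoly ht
    refine ⟨ht'.1, ht'.2.1, ?_⟩
    rw [e]
    refine dvd_pow ?_ Nat.card_pos.ne'
    rw [orbitPoly_eq]
    exact Finset.dvd_prod_of_mem _ ((Set.Finite.mem_toFinset _).mpr ht)

end Counting

/-! ### The correspondence between irreducibles and orbits -/

section Bijection

variable {F : Type*} [Field F] {G : Subgroup PGL(2, F)} [Finite G] {g h : F[X]}

theorem IsQuotientMap.exists_regular_root (hQ : IsQuotientMap G g h) {f : F[X]} (hf : f.Monic)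
    (hfi : Irreducible f) : ∃ α : regularPoints (AlgebraicClosure F) G,
      aeval (aeval (α : AlgebraicClosure F) g / aeval (α : AlgebraicClosure F) h) f = 0 := by
  have hd := (monic_ratTransform hQ.monic hQ.natDegree_lt hf).2
  have hpos : 0 < (ratTransform g h f).natDegree := by
    rw [hd, hQ.natDegree_num]
    exact Nat.mul_pos hfi.natDegree_pos Nat.card_pos
  obtain ⟨α, hα⟩ := IsAlgClosed.exists_aeval_eq_zero (AlgebraicClosure F) (ratTransform g h f)
    (natDegree_pos_iff_degree_pos.mp hpos).ne'
  obtain ⟨hr, h0⟩ := (hQ.root_iff hf α).mp hα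
  exact ⟨⟨α, hr⟩, h0⟩

variable [PerfectField F]

/-- A root α of any one factor recovers f as the minimal polynomial of Q(α). -/
theorem IsQuotientMap.transformFactors_injOn (hQ : IsQuotientMap G g h) (m : ℕ) :
    Set.InjOn (transformFactors g h) (monicIrreducibles F m) := by
  rintro f ⟨hf, hfi, -⟩ f' ⟨hf', hfi', -⟩ e
  obtain ⟨α, hα⟩ := hQ.exists_regular_root hf hfi
  have h1 := minpoly_mem_orbit (F := F) α
  rw [← hQ.transformFactors_eq hf hfi α hα, e] at h1
  have h2 : aeval (α : AlgebraicClosure F) (ratTransform g h f') = 0 :=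
    aeval_eq_zero_of_dvd_aeval_eq_zero h1.2.2 (minpoly.aeval _ _)
  rw [minpoly.eq_of_irreducible_of_monic hfi hα hf,
    minpoly.eq_of_irreducible_of_monic hfi' ((hQ.root_iff hf' _).mp h2).2 hf']

theorem IsQuotientMap.natDegree_mul_card (hQ : IsQuotientMap G g h) {f : F[X]} (hf : f.Monic)
    (hfi : Irreducible f) (α : regularPoints (AlgebraicClosure F) G)
    (hfα : aeval (aeval (α : AlgebraicClosure F) g / aeval (α : AlgebraicClosure F) h) f = 0) :
    f.natDegree * Nat.card G = Nat.card (MulAction.stabilizer G α) *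
      ((orbit G (minpoly F (α : AlgebraicClosure F))).ncard *
        (minpoly F (α : AlgebraicClosure F)).natDegree) := by
  rw [← natDegree_orbitPoly, ← natDegree_pow, ← hQ.ratTransform_eq_pow hf hfi α hfα,
    (monic_ratTransform hQ.monic hQ.natDegree_lt hf).2, hQ.natDegree_num]

theorem IsQuotientMap.image_transformFactors (hQ : IsQuotientMap G g h) {s : ℕ} (hs : s.Prime)
    (hcard : Nat.card G = s) {m : ℕ} (hm : d G < m) :
    transformFactors g h '' monicIrreducibles F m =
      orbitsOfSize G m s ∪ orbitsOfSize G (m * s) 1 := by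
  have hs0 := hs.pos
  ext O
  constructor
  · rintro ⟨f, ⟨hf, hfi, hfm⟩, rfl⟩
    obtain ⟨α, hα⟩ := hQ.exists_regular_root hf hfi
    have hint : IsIntegral F (α : AlgebraicClosure F) := Algebra.IsIntegral.isIntegral _
    have hst : Nat.card (MulAction.stabilizer G α) = 1 := by
      by_contra hne
      have := hQ.natDegree_le_d_of_stabilizer hf hfi α hα hne
      omega
    have hdeg := hQ.natDegree_mul_card hf hfi α hα
    rw [hst, one_mul, hcard, hfm] at hdeg
    rw [hQ.transformFactors_eq hf hfi α hα]
    rcases ncard_orbit_of_prime hs hcard α with ho | ho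
    · left
      rw [ho, mul_comm] at hdeg
      exact ⟨_, ⟨minpoly.monic hint, minpoly.irreducible hint,
        (Nat.eq_of_mul_eq_mul_left hs0 hdeg).symm⟩, rfl, ho⟩
    · right
      rw [ho, one_mul] at hdeg
      exact ⟨_, ⟨minpoly.monic hint, minpoly.irreducible hint, hdeg.symm⟩, rfl, ho⟩
  · intro hO
    -- Both kinds of orbit enter only through these two relations; the bound m ≤ deg r serves to
    -- exclude nonregular roots, which have degree 1.
    obtain ⟨r, hr, hri, rfl, hdeg, hrm⟩ : ∃ r : F[X], r.Monic ∧ Irreducible r ∧ O = orbit G r ∧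
        O.ncard * r.natDegree = m * s ∧ m ≤ r.natDegree := by
      rcases hO with ⟨r, ⟨hr, hri, hrm⟩, e, ho⟩ | ⟨r, ⟨hr, hri, hrm⟩, e, ho⟩
      · exact ⟨r, hr, hri, e, by rw [ho, hrm, mul_comm], hrm.ge⟩
      · exact ⟨r, hr, hri, e, by rw [ho, hrm, one_mul],
          hrm ▸ Nat.le_mul_of_pos_right m hs0⟩
    obtain ⟨α, rfl⟩ := exists_minpoly_eq hr hri
    have hreg : α ∈ regularPoints (AlgebraicClosure F) G := by
      by_contra hne
      obtain ⟨h1, A, hA, hc⟩ := natDegree_minpoly_of_notMem hne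
      have := one_le_d hs hcard hA hc
      omega
    lift α to regularPoints (AlgebraicClosure F) G using hreg
    set β := aeval (α : AlgebraicClosure F) g / aeval (α : AlgebraicClosure F) h with hβ
    have hint : IsIntegral F β := Algebra.IsIntegral.isIntegral _
    have hf := minpoly.monic hint
    have hfi := minpoly.irreducible hint
    have hα : aeval β (minpoly F β) = 0 := minpoly.aeval _ _
    have hd := hQ.natDegree_mul_card hf hfi α hα
    rw [hdeg, hcard, ← mul_assoc] at hd
    have hd' := Nat.eq_of_mul_eq_mul_right hs0 hd
    have hpos : 0 < Nat.card (MulAction.stabilizer G α) := Nat.card_pos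
    -- The minimal polynomial of β has degree |Stab α| · m ≥ m > d(G), whereas a nontrivial
    -- stabilizer would bound it by d(G).
    have hst : Nat.card (MulAction.stabilizer G α) = 1 := by
      by_contra hne
      have := hQ.natDegree_le_d_of_stabilizer hf hfi α hα hne
      have := Nat.le_mul_of_pos_left m hpos
      omega
    rw [hst, one_mul] at hd'
    exact ⟨_, ⟨hf, hfi, hd'⟩, hQ.transformFactors_eq hf hfi α hα⟩

end Bijection

end PolyOrbit

theorem corollary5 {F : Type*} [Field F] [Finite F]
    (G : Subgroup (Matrix.ProjGenLinGroup (Fin 2) F)) (hG : IsCyclic G)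
    (s : ℕ) (hs : s.Prime) (hcard : Nat.card G = s)
    (m : ℕ) (hm : PolyOrbit.d G < m) :
    PolyOrbit.N F m = PolyOrbit.omega G m s + PolyOrbit.omega G (m * s) 1 := by
  have : Finite G := Nat.finite_of_card_ne_zero (hcard ▸ hs.ne_zero)
  obtain ⟨g, h, hQ⟩ := PolyOrbit.exists_isQuotientMap G
  have himg := hQ.image_transformFactors hs hcard hm
  have hfin := (PolyOrbit.finite_monicIrreducibles (F := F) m).image
    (PolyOrbit.transformFactors g h)
  rw [himg] at hfin
  have hdisj : Disjoint (PolyOrbit.orbitsOfSize G m s) (PolyOrbit.orbitsOfSize G (m * s) 1) := by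
    rw [Set.disjoint_left]
    rintro O ⟨_, _, _, h1⟩ ⟨_, _, _, h2⟩
    exact hs.ne_one (h1.symm.trans h2)
  change (PolyOrbit.monicIrreducibles F m).ncard = (PolyOrbit.orbitsOfSize G m s).ncard +
    (PolyOrbit.orbitsOfSize G (m * s) 1).ncard
  rw [← Set.ncard_union_eq hdisj (hfin.subset Set.subset_union_left)
    (hfin.subset Set.subset_union_right), ← himg,
    (hQ.transformFactors_injOn m).ncard_image]
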